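/- A vertex operator superalgebra $(V,Y,\mathbf 1,\omega)$ over $\mathbb C$ is a $\mathbb Z/2$-graded vector space $V$ (parity $p$), equipped with a $\frac12\mathbb Z$-grading by degree $V=\bigoplus_{n\in\frac12\mathbb Z}V_n$ (it is not assumed that integral degree is equivalent to even parity), an even linear map $Y(\cdot,x):V\to \mathrm{Hom}(V,V((x)))$, an even vacuum $\mathbf 1\in V_0$ with $Y(\mathbf 1,x)=\mathrm{Id}$, $Y(v,x)\mathbf 1\in V[[x]]$ and $\lim_{x\to0}Y(v,x)\mathbf 1=v$, and an even $\omega\in V_2$ such that the modes of $Y(\omega,x)=\sum_{m\in\mathbb Z}L(m)x^{-m-2}$ satisfy the Virasoro relations with some central charge $c\in\mathbb C$, $L(0)v=nv$ for $v\in V_n$, $Y(L(-1)v,x)=\frac{d}{dx}Y(v,x)$, and the Jacobi identity $$x_0^{-1}\delta\!\left(\tfrac{x_1-x_2}{x_0}\right)Y(u,x_1)Y(v,x_2)-\epsilon_{u,v}\,x_0^{-1}\delta\!\left(\tfrac{x_2-x_1}{-x_0}\right)Y(v,x_2)Y(u,x_1)=x_2^{-1}\delta\!\left(\tfrac{x_1-x_0}{x_2}\right)Y(Y(u,x_0)v,x_2)$$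 holds for $u,v$ of definite parity, where $\epsilon_{u,v}=(-1)^{p(u)p(v)}$ and $\delta(x)=\sum_{n\in\mathbb Z}x^n$. Powers of a binomial are expanded in nonnegative powers of its second term. Put $X(u,x)=Y(x^{L(0)}u,x)$ and $Y[u,x]=Y(e^{xL(0)}u,e^x-1)$ (negative powers of $e^x-1$ are taken in the field $\mathbb C((x))$); both are extended coefficientwise to series with coefficients in $V$. For $r\in\mathbb Q$ put $\delta_r(x)=x^r\delta(x)=\sum_{n\in\mathbb Z}x^{n+r}$, and for a vector $u$ homogeneous in degree put $\mathrm{rel}(u)=\deg u-\lfloor\deg u\rfloor\in\{0,\frac12\}$. "Homogeneous" below means homogeneous with respect to both degree and parity. **Proposition.** Let $V$ be a vertex operator superalgebra. In each identity all products of formal series exist: applied to any vector of $V$, every coefficient is a finite sum. (1) For all homogeneous $u,v\in V$, $$x_0^{-1}\delta\!\left(\frac{e^{y_{2,1}}x_1}{x_0}\right)X(u,x_1)X(v,x_2)-\epsilon_{u,v}\,x_0^{-1}\delta\!\left(\frac{-e^{y_{1,2}}x_2}{x_0}\right)X(v,x_2)X(u,x_1)=x_1^{-1}\,\delta_{\mathrm{rel}(u)}\!\left(\frac{e^{y}x_2}{x_1}\right)X(Y[u,y]v,x_2),$$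 where $y_{2,1}=\log\left(1-\frac{x_2}{x_1}\right)$, $y_{1,2}=\log\left(1-\frac{x_1}{x_2}\right)$ and $y=\log\left(1+\frac{x_0}{x_2}\right)$ are power series in $x_2/x_1$, $x_1/x_2$ and $x_0/x_2$ respectively. (2) For all homogeneous $u,v\in V$, with $y$ now a formal variable and $[A,B]=AB-\epsilon BA$ the supercommutator (here $\epsilon=\epsilon_{u,v}$), $$[X(u,x_1),X(v,x_2)]=\mathrm{Res}_y\,\delta_{\mathrm{rel}(u)}\!\left(\frac{e^{y}x_2}{x_1}\right)X(Y[u,y]v,x_2).$$ (3) For all homogeneous $u_1,v_1,u_2,v_2\in V$, with $y$ a formal variable and the supercommutator taken with sign $\epsilon=(-1)^{(p(u_1)+p(v_1))(p(u_2)+p(v_2))}$, $$[X(Y[u_1,x_1]v_1,y_1),X(Y[u_2,x_2]v_2,y_2)]=\mathrm{Res}_y\,\delta_{\mathrm{rel}(u_1)+\mathrm{rel}(v_1)}\!\left(\frac{e^{y}y_2}{y_1}\right)X\big(Y[Y[u_1,x_1]v_1,y]\,Y[u_2,x_2]v_2,\,y_2\big).$$ -/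

import Mathlib

open scoped PowerSeries

noncomputable section

/-! ### Formal calculus

A formal series in commuting variables with coefficients in `M` is the function that sends an
exponent vector (an element of an additive group `Γ`, e.g. `ℚ × ℚ × ℚ` for three variables) to the
corresponding coefficient. No support condition is imposed. -/

namespace FormalCalculus

/-- The formal series `∑ i, c i · x^(e i)`. -/
def formalSum {ι Γ M : Type*} [AddCommMonoid M] (c : ι → M) (e : ι → Γ) : Γ → M :=
  fun a => ∑ᶠ (i : ι) (_ : e i = a), c i

/-- The product of a scalar series `f` and a series `g`. It is meaningful when it exists, see
`MulExists`. -/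
def formalMul {Γ M : Type*} [AddCommGroup Γ] [AddCommGroup M] [Module ℂ M]
    (f : Γ → ℂ) (g : Γ → M) : Γ → M :=
  fun a => ∑ᶠ b : Γ, f b • g (a - b)

/-- The product of two formal series exists: every coefficient of it is a finite sum. -/
def MulExists {Γ M : Type*} [AddCommGroup Γ] [AddCommGroup M] [Module ℂ M]
    (f : Γ → ℂ) (g : Γ → M) : Prop :=
  ∀ a : Γ, {b : Γ | f b • g (a - b) ≠ 0}.Finite

/-- Multiplication by the monomial `x^e`. -/
def monomialMul {Γ M : Type*} [AddCommGroup Γ] (e : Γ) (f : Γ → M) : Γ → M :=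
  fun a => f (a - e)

/-- A series in the last two of three variables, regarded as a series in all three. -/
def liftLastTwo {M : Type*} [AddCommMonoid M] {R : Type*} [DecidableEq R] [Zero R]
    (g : R × R → M) : R × R × R → M :=
  fun a => if a.1 = 0 then g a.2 else 0

/-- The residue (coefficient of the power `-1`) with respect to the first of three variables. -/
def res {M : Type*} (f : ℚ × ℚ × ℚ → M) : ℚ × ℚ → M :=
  fun a => f (-1, a)

/-- For monomials `A = x^a`, `B = x^b`, `C = x^c` and a sign `s`, the series
`C⁻¹ δ((A - B) / (s C)) = ∑_{n ∈ ℤ} s^n C^(-n-1) (A - B)^n`,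
where `(A - B)^n` is expanded in nonnegative powers of `B`. -/
def deltaSub (s : ℤˣ) (a b c : ℤ × ℤ × ℤ) : ℤ × ℤ × ℤ → ℂ :=
  formalSum
    (fun p : ℤ × ℕ => (((s ^ p.1 : ℤˣ) : ℤ) : ℂ) * ((-1) ^ p.2 * ((Ring.choose p.1 p.2 : ℤ) : ℂ)))
    (fun p => (p.1 - (p.2 : ℤ)) • a + (p.2 : ℤ) • b - (p.1 + 1) • c)

/-- The coefficient of `z^j` in the formal power series `e^{s L(z)}`, where `L` has zero constant
term. -/
def expCoeff (L : ℂ⟦X⟧) (s : ℚ) (j : ℕ) : ℂ :=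
  PowerSeries.coeff j ((PowerSeries.exp ℂ).subst ((s : ℂ) • L))

/-- `δ_r(e^{L(z)} q) = ∑_{n ∈ ℤ} e^{(n + r) L(z)} q^(n + r)`, for `δ_r(x) = x^r δ(x)`; here `L` is a
power series with zero constant term, and `z`, `q` stand for the monomials with these exponent
vectors. -/
def expDelta (L : ℂ⟦X⟧) (z q : ℚ × ℚ × ℚ) (r : ℚ) : ℚ × ℚ × ℚ → ℂ :=
  formalSum (fun p : ℤ × ℕ => expCoeff L (p.1 + r) p.2)
    (fun p => ((p.1 : ℚ) + r) • q + (p.2 : ℚ) • z)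

/-- `δ(-e^{L(z)} q) = ∑_{n ∈ ℤ} (-1)^n e^{n L(z)} q^n`. -/
def negExpDelta (L : ℂ⟦X⟧) (z q : ℚ × ℚ × ℚ) : ℚ × ℚ × ℚ → ℂ :=
  formalSum (fun p : ℤ × ℕ => (-1 : ℂ) ^ p.1 * expCoeff L p.1 p.2)
    (fun p => (p.1 : ℚ) • q + (p.2 : ℚ) • z)

/-- `log(1 + z)` as a power series in `z`. -/
def logOnePlus : ℂ⟦X⟧ := PowerSeries.log ℂ

/-- `log(1 - z)` as a power series in `z`. -/
def logOneMinus : ℂ⟦X⟧ := PowerSeries.rescale (-1 : ℂ) (PowerSeries.log ℂ)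

/-- The sign `(-1)^{ij}` for parities `i`, `j`. -/
def paritySign (i j : ZMod 2) : ℂ := (-1) ^ (i.val * j.val)

end FormalCalculus

open FormalCalculus

/-- `L(n)`, the coefficient of `x^{-n-2}` in `Y(ω, x)`. -/
def virasoroMode {V : Type*} [AddCommGroup V] [Module ℂ V] (Y : V →ₗ[ℂ] VertexOperator ℂ V)
    (ω : V) (n : ℤ) : Module.End ℂ V :=
  HVertexOperator.coeff (Y ω) (-n - 2)

/-- A vertex operator superalgebra structure `(V, Y, 1, ω)` on a complex vector space `V`.
The degrees are half-integers: `deg k` is the subspace of degree `k / 2`, for `k : ℤ`. The parity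
is an independent `ℤ/2`-grading: it is not assumed that integral degree means even.
The coefficient of `x^n` in `Y(u, x) w` is `HVertexOperator.coeff (Y u) n w`; the truncation
property `Y(u, x) w ∈ V((x))` is part of the type of `Y`. -/
structure VertexOperatorSuperalgebra (V : Type*) [AddCommGroup V] [Module ℂ V] where
  /-- even and odd subspaces -/
  par : ZMod 2 → Submodule ℂ V
  par_internal : DirectSum.IsInternal par
  /-- `deg k` is the subspace of vectors of degree `k / 2` -/
  deg : ℤ → Submodule ℂ V
  deg_internal : DirectSum.IsInternal deg
  /-- the map `u ↦ Y(u, x)` -/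
  Y : V →ₗ[ℂ] VertexOperator ℂ V
  /-- `Y` is an even map -/
  Y_par : ∀ (i j : ZMod 2) (u v : V) (n : ℤ), u ∈ par i → v ∈ par j →
    HVertexOperator.coeff (Y u) n v ∈ par (i + j)
  /-- the vacuum vector -/
  one : V
  one_deg : one ∈ deg 0
  one_par : one ∈ par 0
  /-- the conformal vector, of degree `2` -/
  ω : V
  ω_deg : ω ∈ deg 4
  ω_par : ω ∈ par 0
  /-- the central charge -/
  c : ℂ
  vacuum : ∀ (n : ℤ) (w : V), HVertexOperator.coeff (Y one) n w = if n = 0 then w else 0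
  creation_regular : ∀ (v : V) (n : ℤ), n < 0 → HVertexOperator.coeff (Y v) n one = 0
  creation_limit : ∀ v : V, HVertexOperator.coeff (Y v) 0 one = v
  /-- the Jacobi identity, applied to a vector `w`; the variables are `x₀, x₁, x₂`:
  `x₀⁻¹ δ((x₁ - x₂)/x₀) Y(u,x₁) Y(v,x₂) w - ε x₀⁻¹ δ((x₂ - x₁)/(-x₀)) Y(v,x₂) Y(u,x₁) w
    = x₂⁻¹ δ((x₁ - x₀)/x₂) Y(Y(u,x₀)v,x₂) w`. -/
  jacobi : ∀ (i j : ZMod 2) (u v w : V), u ∈ par i → v ∈ par j →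
    formalMul (deltaSub 1 (0, 1, 0) (0, 0, 1) (1, 0, 0))
        (liftLastTwo fun a =>
          HVertexOperator.coeff (Y u) a.1 (HVertexOperator.coeff (Y v) a.2 w))
      - paritySign i j •
        formalMul (deltaSub (-1) (0, 0, 1) (0, 1, 0) (1, 0, 0))
          (liftLastTwo fun a =>
            HVertexOperator.coeff (Y v) a.2 (HVertexOperator.coeff (Y u) a.1 w))
      = formalMul (deltaSub 1 (0, 1, 0) (1, 0, 0) (0, 0, 1))
          (fun a => if a.2.1 = 0 then
            HVertexOperator.coeff (Y (HVertexOperator.coeff (Y u) a.1 v)) a.2.2 w else 0)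
  /-- the Virasoro relations -/
  virasoro : ∀ m n : ℤ,
    virasoroMode Y ω m * virasoroMode Y ω n - virasoroMode Y ω n * virasoroMode Y ω m
      = ((m : ℂ) - n) • virasoroMode Y ω (m + n)
        + (if m + n = 0 then ((m : ℂ) ^ 3 - m) / 12 * c else 0) • (1 : Module.End ℂ V)
  /-- `L(0)` acts on a vector as multiplication by its degree -/
  L_zero : ∀ (k : ℤ) (v : V), v ∈ deg k → virasoroMode Y ω 0 v = ((k : ℂ) / 2) • v
  /-- `Y(L(-1) v, x) = d/dx Y(v, x)` -/
  L_neg_one : ∀ (v : V) (n : ℤ),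
    HVertexOperator.coeff (Y (virasoroMode Y ω (-1) v)) n
      = ((n : ℂ) + 1) • HVertexOperator.coeff (Y v) (n + 1)

namespace VertexOperatorSuperalgebra

variable {V : Type*} [AddCommGroup V] [Module ℂ V] (S : VertexOperatorSuperalgebra V)

/-- The component of degree `k / 2` of a vector. -/
def component (k : ℤ) (u : V) : V :=
  letI := S.deg_internal.chooseDecomposition
  (DirectSum.decompose S.deg u k : V)

/-- `rel(u) = deg(u) - [deg(u)] ∈ {0, 1/2}` for `u` of degree `k / 2`. -/
def rel (k : ℤ) : ℚ := Int.fract ((k : ℚ) / 2)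

/-- The series `X(u, x) w = Y(x^{L(0)} u, x) w = ∑_k x^{k/2} Y(u_k, x) w`, where `u_k` is the
component of `u` of degree `k / 2`. -/
def X (u w : V) : ℚ → V :=
  formalSum (fun p : ℤ × ℤ => HVertexOperator.coeff (S.Y (S.component p.1 u)) p.2 w)
    (fun p => (p.1 : ℚ) / 2 + p.2)

/-- The series `X(u, x₁) X(v, x₂) w` in `x₁, x₂`. -/
def XX (u v w : V) : ℚ × ℚ → V := fun a => S.X u (S.X v w a.2) a.1

/-- The series `X(v, x₂) X(u, x₁) w` in `x₁, x₂`. -/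
def XXop (u v w : V) : ℚ × ℚ → V := fun a => S.X v (S.X u w a.1) a.2

/-- The supercommutator `[X(u, x₁), X(v, x₂)] w`, for `u` of parity `i` and `v` of parity `j`. -/
def superCommutator (i j : ZMod 2) (u v w : V) : ℚ × ℚ → V :=
  S.XX u v w - paritySign i j • S.XXop u v w

/-- The Laurent series `e^y - 1` in `y`; its negative powers are those in the field `ℂ((y))`. -/
def expSubOne : LaurentSeries ℂ := ((PowerSeries.exp ℂ - 1 : ℂ⟦X⟧) : LaurentSeries ℂ)

/-- The coefficient of `y^k` in `Y[u, y] v = Y(e^{y L(0)} u, e^y - 1) v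
  = ∑_{i ≥ 0, n ∈ ℤ} (y^i / i!) (e^y - 1)^n · (coefficient of x^n in Y(L(0)^i u, x) v)`. -/
def bracket (u v : V) (k : ℤ) : V :=
  ∑ᶠ p : ℕ × ℤ, (((p.1.factorial : ℂ))⁻¹ * (expSubOne ^ p.2).coeff (k - p.1)) •
    HVertexOperator.coeff (S.Y ((virasoroMode S.Y S.ω 0 ^ p.1) u)) p.2 v

/-- The series `X(Y[u, y] v, x₂) w` with `y = L(z)`, where `L` is a power series with zero constant
term and nonzero linear term, and `z` stands for the monomial with this exponent vector (the last
of the three variables is `x₂`); negative powers of `L(z)` are expanded as Laurent series in `z`.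
For `L = PowerSeries.X`, `y = z` is a formal variable. -/
def XBracket (L : ℂ⟦X⟧) (z : ℚ × ℚ × ℚ) (u v w : V) : ℚ × ℚ × ℚ → V :=
  formalSum
    (fun p : ℤ × ℤ × ℚ =>
      ((L : LaurentSeries ℂ) ^ p.1).coeff p.2.1 • S.X (S.bracket u v p.1) w p.2.2)
    (fun p => (p.2.1 : ℚ) • z + p.2.2 • ((0, 0, 1) : ℚ × ℚ × ℚ))

end VertexOperatorSuperalgebra

end

open FormalCalculus VertexOperatorSuperalgebra

noncomputable section

/-! For homogeneous `u` of degree `k/2`, the operator `x^{L(0)}` only multiplies `Y(u,x)` by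
`x^{k/2}`, and `e^{yL(0)}` only multiplies by the scalar series `e^{ky/2}`. Hence the left side of
(1) is the ordinary Jacobi identity shifted by `x₁^{k/2} x₂^{l/2}`, and all the content lies on the
right side.

There, write `u_m v` for the coefficient of `x^m` in `Y(u,x)v`. The factor `e^{(n+r)L}` of the delta
function combines with `e^{kL/2}`, so the coefficient attached to `u_m v` comes from the scalar
Laurent series `e^{NL}(e^L-1)^m` with `N = n+r+k/2` (`formalMul_XBracket_of_mem`). The twist `r =
rel(u)` is exactly what makes `N` an integer. Two evaluations finish the comparison: - for `L =
log(1+z)` the series is `(1+z)^N z^m`, whose coefficients are the binomials of the iterate term of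
the Jacobi identity (`coeff_expLaurent_log`); - for `L = y` the residue is `Res_x (1+x)^{N-1} x^m`
under `x = e^y-1`, the binomial of the commutator formula for modes (`coeff_neg_one_expLaurent_X`,
`mode_commutator`).

To place `u_m v` in the right degree, additivity of degrees is derived from the commutator with
`L(0)` (`mode_mem_deg`).

For (3), the coefficients of `Y[u₁,x₁]v₁` are sums of vectors of one parity whose degrees agree
modulo `ℤ`. Both sides of (2) are bilinear in the two vectors and involve the degree of the first
only modulo `ℤ`, so the formula extends to such sums (`superCommutator_of_mem_cosetSpan`). -/

namespace FormalCalculus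

/-! ### Exponentials of power series -/

/-- The power series `e^{s L}`. -/
def expSubst (L : ℂ⟦X⟧) (s : ℚ) : ℂ⟦X⟧ := (PowerSeries.exp ℂ).subst ((s : ℂ) • L)

theorem expCoeff_eq (L : ℂ⟦X⟧) (s : ℚ) (j : ℕ) :
    expCoeff L s j = PowerSeries.coeff j (expSubst L s) := rfl

theorem expSubst_eq_rescale {L : ℂ⟦X⟧} (hL : PowerSeries.constantCoeff L = 0) (s : ℚ) :
    expSubst L s = (PowerSeries.rescale (s : ℂ) (PowerSeries.exp ℂ)).subst L := by
  have h : PowerSeries.HasSubst L := PowerSeries.HasSubst.of_constantCoeff_zero' hL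
  rw [PowerSeries.rescale_eq_subst, PowerSeries.subst_comp_subst_apply
    (PowerSeries.HasSubst.smul_X' _) h, PowerSeries.subst_smul h, PowerSeries.subst_X h]
  rfl

theorem expSubst_add {L : ℂ⟦X⟧} (hL : PowerSeries.constantCoeff L = 0) (s t : ℚ) :
    expSubst L (s + t) = expSubst L s * expSubst L t := by
  have h : PowerSeries.HasSubst L := PowerSeries.HasSubst.of_constantCoeff_zero' hL
  simp only [expSubst_eq_rescale hL]
  rw [← PowerSeries.subst_mul h, PowerSeries.exp_mul_exp_eq_exp_add]
  push_cast; rfl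

theorem expSubst_zero {L : ℂ⟦X⟧} (hL : PowerSeries.constantCoeff L = 0) :
    expSubst L 0 = 1 := by
  have h : PowerSeries.HasSubst L := PowerSeries.HasSubst.of_constantCoeff_zero' hL
  rw [expSubst_eq_rescale hL, ← PowerSeries.coe_substAlgHom h]
  simp

theorem expSubst_one (L : ℂ⟦X⟧) :
    expSubst L 1 = (PowerSeries.exp ℂ).subst L := by
  simp [expSubst]

theorem expSubst_X_subst {L : ℂ⟦X⟧} (hL : PowerSeries.constantCoeff L = 0) (s : ℚ) :
    (expSubst PowerSeries.X s).subst L = expSubst L s := by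
  rw [expSubst_eq_rescale hL, expSubst_eq_rescale PowerSeries.constantCoeff_X,
    PowerSeries.X_subst]

theorem constantCoeff_expSubst {L : ℂ⟦X⟧} (hL : PowerSeries.constantCoeff L = 0) (s : ℚ) :
    PowerSeries.constantCoeff (expSubst L s) = 1 := by
  have h0 : PowerSeries.constantCoeff
      ((PowerSeries.rescale (s : ℂ) (PowerSeries.exp ℂ) - 1).subst L) = 0 := by
    have := PowerSeries.constantCoeff_subst_eq_zero (a := L) hL
      (PowerSeries.rescale (s : ℂ) (PowerSeries.exp ℂ) - 1) (by
        rw [map_sub, ← PowerSeries.coeff_zero_eq_constantCoeff_apply, PowerSeries.coeff_rescale]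
        simp)
    exact this
  have h : PowerSeries.HasSubst L := PowerSeries.HasSubst.of_constantCoeff_zero' hL
  rw [PowerSeries.subst_sub h, ← expSubst_eq_rescale hL, ← PowerSeries.coe_substAlgHom h, map_one,
    map_sub, map_one, sub_eq_zero] at h0
  exact h0

/-- The series `f = e^{log(1+z)}` solves `(1+z) f' = f` with `f(0) = 1`. The recursion `(n+1)
f_{n+1} = (1-n) f_n` gives `f_1 = 1` and kills every coefficient from degree 2 on. -/
theorem expSubst_log_one : expSubst (PowerSeries.log ℂ) 1 = 1 + PowerSeries.X := by
  have h : PowerSeries.HasSubst (PowerSeries.log ℂ) := PowerSeries.HasSubst.log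
  have hL : PowerSeries.constantCoeff (PowerSeries.log ℂ) = 0 := PowerSeries.constantCoeff_log
  set f := expSubst (PowerSeries.log ℂ) 1 with hf
  have hlog : PowerSeries.derivative ℂ (PowerSeries.log ℂ) * (1 + PowerSeries.X) = 1 := by
    rw [PowerSeries.deriv_log]
    ext n
    rw [mul_add, mul_one]
    cases n with
    | zero => simp
    | succ n => simp [PowerSeries.coeff_succ_mul_X, pow_succ, PowerSeries.coeff_one]
  have hd : PowerSeries.derivative ℂ f * (1 + PowerSeries.X) = f := by
    rw [hf, expSubst_one, PowerSeries.derivative_subst h, PowerSeries.derivative_exp,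
      mul_assoc, hlog, mul_one]
  have h0 : PowerSeries.coeff 0 f = 1 := by
    rw [PowerSeries.coeff_zero_eq_constantCoeff_apply, constantCoeff_expSubst hL]
  have hrec : ∀ n : ℕ, PowerSeries.coeff (n + 1) f * (n + 1) + PowerSeries.coeff n f * n
      = PowerSeries.coeff n f := by
    intro n
    have := congrArg (PowerSeries.coeff n) hd
    rw [mul_add, mul_one, map_add] at this
    cases n with
    | zero => simpa [PowerSeries.coeff_derivative] using this
    | succ n =>
      rw [PowerSeries.coeff_succ_mul_X, PowerSeries.coeff_derivative,
        PowerSeries.coeff_derivative] at this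
      push_cast at this ⊢
      exact this
  have h1 : PowerSeries.coeff 1 f = 1 := by simpa [h0] using hrec 0
  have h2 : ∀ n : ℕ, PowerSeries.coeff (n + 2) f = 0 := by
    intro n
    induction n with
    | zero =>
      have := hrec 1
      rw [h1] at this
      have h3 : PowerSeries.coeff 2 f * ((1 : ℂ) + 1) = 0 := by
        have : PowerSeries.coeff 2 f * ((1 : ℂ) + 1) + 1 = 1 := by simpa using this
        linear_combination this
      simpa using h3
    | succ n ih =>
      have := hrec (n + 2)
      rw [ih] at this
      have h3 : ((n : ℂ) + 3) ≠ 0 := by exact_mod_cast (by omega : n + 3 ≠ 0)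
      have h4 : PowerSeries.coeff (n + 1 + 2) f * ((n : ℂ) + 3) = 0 := by
        push_cast at this
        rw [show n + 1 + 2 = n + 2 + 1 by ring]
        linear_combination this
      exact (mul_eq_zero.mp h4).resolve_right h3
  ext n
  match n with
  | 0 => simp [h0]
  | 1 => simp [h1, PowerSeries.coeff_one]
  | n + 2 => simp [h2, PowerSeries.coeff_one, PowerSeries.coeff_X]

/-- Natural exponents are powers of `1 + z`; for negative ones both sides are inverse to the same
series. -/
theorem expSubst_log_intCast (n : ℤ) :
    expSubst (PowerSeries.log ℂ) n = PowerSeries.binomialSeries ℂ n := by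
  have hL : PowerSeries.constantCoeff (PowerSeries.log ℂ) = 0 := PowerSeries.constantCoeff_log
  have hnat : ∀ n : ℕ, expSubst (PowerSeries.log ℂ) n = PowerSeries.binomialSeries ℂ (n : ℤ) := by
    intro n
    rw [PowerSeries.binomialSeries_nat]
    induction n with
    | zero => simpa using expSubst_zero hL
    | succ n ih => rw [Nat.cast_succ, expSubst_add hL, ih, expSubst_log_one, pow_succ]
  obtain ⟨m, rfl | rfl⟩ := n.eq_nat_or_neg
  · exact_mod_cast hnat m
  · have h1 : expSubst (PowerSeries.log ℂ) m * expSubst (PowerSeries.log ℂ) (-m : ℚ) = 1 := by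
      rw [← expSubst_add hL, add_neg_cancel, expSubst_zero hL]
    have h2 : PowerSeries.binomialSeries ℂ (m : ℤ) * PowerSeries.binomialSeries ℂ (-m : ℤ) = 1 := by
      rw [← PowerSeries.binomialSeries_add, add_neg_cancel, PowerSeries.binomialSeries_zero]
    rw [← hnat m] at h2
    push_cast
    exact mul_left_cancel₀ (left_ne_zero_of_mul_eq_one h1) (h1.trans h2.symm)

theorem expCoeff_logOnePlus (n : ℤ) (j : ℕ) :
    expCoeff logOnePlus n j = (Ring.choose n j : ℤ) := by
  rw [expCoeff_eq, logOnePlus, expSubst_log_intCast]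
  simp

theorem constantCoeff_logOneMinus : PowerSeries.constantCoeff logOneMinus = 0 := by
  rw [logOneMinus, ← PowerSeries.coeff_zero_eq_constantCoeff_apply, PowerSeries.coeff_rescale]
  simp

theorem expCoeff_logOneMinus (n : ℤ) (j : ℕ) :
    expCoeff logOneMinus n j = (-1) ^ j * (Ring.choose n j : ℤ) := by
  have h : PowerSeries.HasSubst (PowerSeries.log ℂ) := PowerSeries.HasSubst.log
  have hX : PowerSeries.HasSubst ((-1 : ℂ) • (PowerSeries.X : ℂ⟦X⟧)) :=
    PowerSeries.HasSubst.smul_X' _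
  rw [← expCoeff_logOnePlus, expCoeff_eq, expCoeff_eq, ← PowerSeries.coeff_rescale]
  congr 1
  rw [expSubst_eq_rescale constantCoeff_logOneMinus, logOnePlus,
    expSubst_eq_rescale PowerSeries.constantCoeff_log, logOneMinus,
    PowerSeries.rescale_eq_subst (-1 : ℂ), PowerSeries.rescale_eq_subst (-1 : ℂ),
    PowerSeries.subst_comp_subst_apply h hX]

/-! ### Laurent series -/

theorem coeff_coe_mul_eq_zero {P : ℂ⟦X⟧} {m q : ℤ} (h : q < m) :
    (HahnSeries.single m (1 : ℂ) * (P : LaurentSeries ℂ)).coeff q = 0 := by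
  rw [HahnSeries.coeff_single_mul, PowerSeries.coeff_coe, if_pos (by omega), mul_zero]

theorem coeff_single_mul_coe (P : ℂ⟦X⟧) (m : ℤ) (j : ℕ) :
    (HahnSeries.single m (1 : ℂ) * (P : LaurentSeries ℂ)).coeff (m + j)
      = PowerSeries.coeff j P := by
  rw [HahnSeries.coeff_single_mul, add_sub_cancel_left, one_mul, LaurentSeries.coeff_coe_powerSeries]

/-- Writing `L` as `z` times a unit turns `L^p`, also for negative `p`, into `z^p` times a power
series. All truncation bounds on powers of `L` come from this. -/
theorem exists_eq_X_mul {L : ℂ⟦X⟧} (hL : PowerSeries.constantCoeff L = 0)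
    (hL1 : PowerSeries.coeff 1 L ≠ 0) : ∃ G : (ℂ⟦X⟧)ˣ, L = PowerSeries.X * (G : ℂ⟦X⟧) := by
  obtain ⟨G, rfl⟩ := PowerSeries.X_dvd_iff.mpr hL
  have hG : IsUnit G := by
    rw [PowerSeries.isUnit_iff_constantCoeff, isUnit_iff_ne_zero]
    intro h
    apply hL1
    rw [show 1 = 0 + 1 from rfl, PowerSeries.coeff_succ_X_mul]
    simpa using h
  exact ⟨hG.unit, rfl⟩

theorem coe_units_zpow (f : ℂ⟦X⟧ →+* LaurentSeries ℂ) (G : (ℂ⟦X⟧)ˣ) (m : ℤ) :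
    f ((G ^ m : (ℂ⟦X⟧)ˣ) : ℂ⟦X⟧) = (f (G : ℂ⟦X⟧)) ^ m := by
  have := congrArg Units.val (map_zpow (Units.map (f : ℂ⟦X⟧ →* LaurentSeries ℂ)) G m)
  rwa [Units.coe_map, Units.val_zpow_eq_zpow_val, Units.coe_map] at this

theorem coe_X_mul_zpow (G : (ℂ⟦X⟧)ˣ) (m : ℤ) :
    (((PowerSeries.X * (G : ℂ⟦X⟧) : ℂ⟦X⟧) : LaurentSeries ℂ)) ^ m
      = HahnSeries.single m (1 : ℂ) * (((G ^ m : (ℂ⟦X⟧)ˣ) : ℂ⟦X⟧) : LaurentSeries ℂ) := by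
  rw [PowerSeries.coe_mul, mul_zpow, PowerSeries.coe_X, ← RatFunc.single_zpow, coe_units_zpow]

theorem coeff_zpow_eq_zero {L : ℂ⟦X⟧} (hL : PowerSeries.constantCoeff L = 0)
    (hL1 : PowerSeries.coeff 1 L ≠ 0) {p q : ℤ} (h : q < p) :
    ((L : LaurentSeries ℂ) ^ p).coeff q = 0 := by
  obtain ⟨G, rfl⟩ := exists_eq_X_mul hL hL1
  rw [coe_X_mul_zpow, coeff_coe_mul_eq_zero h]

/-- A product of a power series and a Laurent series, coefficientwise. -/
theorem coeff_coe_mul (P : ℂ⟦X⟧) (F : LaurentSeries ℂ) (q : ℤ) :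
    ((P : LaurentSeries ℂ) * F).coeff q
      = ∑ᶠ j : ℕ, PowerSeries.coeff j P * F.coeff (q - j) := by
  -- The support of the power series is enlarged to all of `ℕ`, which is still well-ordered, so that
  -- the sum can be indexed by `j`.
  rw [HahnSeries.coeff_mul_left' (s := Set.range (Nat.cast : ℕ → ℤ))]
  rotate_left
  · refine (BddBelow.isWF ⟨0, ?_⟩).isPWO
    rintro _ ⟨n, rfl⟩
    simp
  · intro i hi
    rw [HahnSeries.mem_support, PowerSeries.coeff_coe] at hi
    split_ifs at hi with h
    · exact absurd rfl hi
    · exact ⟨i.natAbs, by omega⟩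
  symm
  rw [← finsum_mem_finset_eq_sum]
  have hinj : Function.Injective (fun j : ℕ => ((j : ℤ), q - (j : ℤ))) := by
    intro a b h
    simpa using h
  rw [← finsum_mem_range (f := fun ij : ℤ × ℤ => (P : LaurentSeries ℂ).coeff ij.1 * F.coeff ij.2)
    hinj |>.trans (finsum_congr fun j => by rw [LaurentSeries.coeff_coe_powerSeries])]
  refine finsum_mem_inter_support_eq _ _ _ ?_
  ext ⟨i, j⟩
  simp only [Set.mem_inter_iff, Set.mem_range, Prod.mk.injEq, Function.mem_support, ne_eq,
    SetLike.mem_coe, Finset.mem_antidiagonal]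
  constructor
  · rintro ⟨⟨n, rfl, rfl⟩, h⟩
    refine ⟨⟨⟨n, rfl⟩, ?_, by ring⟩, h⟩
    exact right_ne_zero_of_mul h
  · rintro ⟨⟨⟨n, rfl⟩, -, h2⟩, h⟩
    exact ⟨⟨n, rfl, by omega⟩, h⟩

/-- The Laurent series `e^{s L} (e^L - 1)^m`. -/
def expLaurent (L : ℂ⟦X⟧) (s : ℚ) (m : ℤ) : LaurentSeries ℂ :=
  (expSubst L s : LaurentSeries ℂ) * ((expSubst L 1 - 1 : ℂ⟦X⟧) : LaurentSeries ℂ) ^ m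

theorem expLaurent_add {L : ℂ⟦X⟧} (hL : PowerSeries.constantCoeff L = 0) (s t : ℚ) (m : ℤ) :
    (expSubst L s : LaurentSeries ℂ) * expLaurent L t m = expLaurent L (s + t) m := by
  rw [expLaurent, expLaurent, expSubst_add hL, PowerSeries.coe_mul, mul_assoc]

theorem expSubst_X_one : expSubst PowerSeries.X 1 = PowerSeries.exp ℂ := by
  rw [expSubst_one, PowerSeries.X_subst]

theorem expSubOne_eq : expSubOne
    = ((expSubst PowerSeries.X 1 - 1 : ℂ⟦X⟧) : LaurentSeries ℂ) := by
  rw [expSubst_X_one, expSubOne]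

theorem exists_exp_sub_one_eq :
    ∃ G : (ℂ⟦X⟧)ˣ, expSubst PowerSeries.X 1 - 1 = PowerSeries.X * (G : ℂ⟦X⟧) := by
  rw [expSubst_X_one]
  apply exists_eq_X_mul
  · simp
  · simp [PowerSeries.coeff_one]

theorem expLaurent_X_eq {G : (ℂ⟦X⟧)ˣ}
    (hG : expSubst PowerSeries.X 1 - 1 = PowerSeries.X * (G : ℂ⟦X⟧)) (s : ℚ) (m : ℤ) :
    expLaurent PowerSeries.X s m = HahnSeries.single m (1 : ℂ) *
      ((expSubst PowerSeries.X s * (G ^ m : (ℂ⟦X⟧)ˣ) : ℂ⟦X⟧) : LaurentSeries ℂ) := by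
  rw [expLaurent, hG, coe_X_mul_zpow, PowerSeries.coe_mul]
  ring

theorem coeff_expLaurent_X_eq_zero (s : ℚ) {m q : ℤ} (h : q < m) :
    (expLaurent PowerSeries.X s m).coeff q = 0 := by
  obtain ⟨G, hG⟩ := exists_exp_sub_one_eq
  rw [expLaurent_X_eq hG, coeff_coe_mul_eq_zero h]

/-- Substituting `L` in the Laurent series `x^m h(x)`. -/
theorem finsum_coeff_zpow_mul {L : ℂ⟦X⟧} (hL : PowerSeries.constantCoeff L = 0)
    (hL1 : PowerSeries.coeff 1 L ≠ 0) (h : ℂ⟦X⟧) (m q : ℤ) :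
    ∑ᶠ p : ℤ, ((L : LaurentSeries ℂ) ^ p).coeff q *
        (HahnSeries.single m (1 : ℂ) * (h : LaurentSeries ℂ)).coeff p
      = ((L : LaurentSeries ℂ) ^ m * ((h.subst L : ℂ⟦X⟧) : LaurentSeries ℂ)).coeff q := by
  have hs : PowerSeries.HasSubst L := PowerSeries.HasSubst.of_constantCoeff_zero' hL
  have hL0 : (L : LaurentSeries ℂ) ≠ 0 := by
    intro h0
    have : L = 0 := HahnSeries.ofPowerSeries_injective (by rw [h0, map_zero])
    simp [this] at hL1
  -- Chosen so that `m + N > q`: the tail of `h` beyond degree `N` contributes `L^{m+N}` times a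
  -- power series, which has no term of degree `q`. What remains is a polynomial in `L`.
  set N : ℕ := (q - m).toNat + 1 with hN
  have hsub : h.subst L = (∑ i ∈ Finset.range N, PowerSeries.coeff i h • L ^ i)
      + L ^ N * (PowerSeries.mk fun i => PowerSeries.coeff (i + N) h).subst L := by
    conv_lhs => rw [PowerSeries.eq_X_pow_mul_shift_add_trunc N h]
    rw [PowerSeries.subst_add hs, PowerSeries.subst_mul hs, PowerSeries.subst_pow hs,
      PowerSeries.subst_X hs, add_comm, PowerSeries.subst_coe hs, Polynomial.aeval_eq_sum_range'
        (PowerSeries.natDegree_trunc_lt h (q - m).toNat)]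
    congr 1
    refine Finset.sum_congr rfl fun i hi => ?_
    rw [PowerSeries.coeff_trunc, if_pos (Finset.mem_range.mp hi)]
  rw [hsub, PowerSeries.coe_add, mul_add, HahnSeries.coeff_add, PowerSeries.coe_mul,
    PowerSeries.coe_pow, ← mul_assoc, ← zpow_natCast, ← zpow_add₀ hL0]
  have hz : ((L : LaurentSeries ℂ) ^ (m + (N : ℤ)) *
      (((PowerSeries.mk fun i => PowerSeries.coeff (i + N) h).subst L : ℂ⟦X⟧) :
        LaurentSeries ℂ)).coeff q = 0 := by
    obtain ⟨G, rfl⟩ := exists_eq_X_mul hL hL1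
    rw [coe_X_mul_zpow, mul_assoc, ← PowerSeries.coe_mul, coeff_coe_mul_eq_zero]
    omega
  rw [hz, add_zero, map_sum, Finset.mul_sum, HahnSeries.coeff_sum]
  have hinj : Function.Injective (fun i : ℕ => m + (i : ℤ)) := by
    intro a b hab
    simpa using hab
  rw [finsum_eq_sum_of_support_subset (s := (Finset.range N).image fun i : ℕ => m + (i : ℤ)),
    Finset.sum_image (fun a _ b _ hab => hinj hab)]
  · refine Finset.sum_congr rfl fun i _ => ?_
    rw [coeff_single_mul_coe, PowerSeries.smul_eq_C_mul, PowerSeries.coe_mul, PowerSeries.coe_C,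
      mul_left_comm, HahnSeries.C_apply, HahnSeries.coeff_single_zero_mul,
      PowerSeries.coe_pow, ← zpow_natCast, ← zpow_add₀ hL0, mul_comm]
  · intro p hp
    rw [Function.mem_support] at hp
    have h1 : p ≤ q := by
      by_contra hc
      exact hp (by rw [coeff_zpow_eq_zero hL hL1 (not_le.mp hc), zero_mul])
    have h2 : m ≤ p := by
      by_contra hc
      exact hp (by rw [coeff_coe_mul_eq_zero (not_le.mp hc), mul_zero])
    simp only [Finset.coe_image, Finset.coe_range, Set.mem_image, Set.mem_Iio]
    exact ⟨(p - m).toNat, by omega, by omega⟩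

/-- This is the substitution `y = L` in `e^{sy}(e^y-1)^m`. It reconciles expanding `Y[u,y]v` in `y`
first, as in `XBracket`, with working directly in powers of `e^L-1`. -/
theorem finsum_coeff_zpow_mul_expLaurent {L : ℂ⟦X⟧} (hL : PowerSeries.constantCoeff L = 0)
    (hL1 : PowerSeries.coeff 1 L ≠ 0) (s : ℚ) (m q : ℤ) :
    ∑ᶠ p : ℤ, ((L : LaurentSeries ℂ) ^ p).coeff q * (expLaurent PowerSeries.X s m).coeff p
      = (expLaurent L s m).coeff q := by
  have hs : PowerSeries.HasSubst L := PowerSeries.HasSubst.of_constantCoeff_zero' hL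
  obtain ⟨G, hG⟩ := exists_exp_sub_one_eq
  rw [expLaurent_X_eq hG, finsum_coeff_zpow_mul hL hL1, PowerSeries.subst_mul hs,
    expSubst_X_subst hL, PowerSeries.coe_mul, mul_left_comm, expLaurent]
  congr 2
  -- Substituting into `e^y - 1 = y G(y)` gives `e^L - 1 = L G(L)`, with `G(L)` again a unit, so
  -- negative powers agree as well.
  have h1 := congrArg (PowerSeries.subst L) hG
  rw [PowerSeries.subst_sub hs, PowerSeries.subst_mul hs, PowerSeries.subst_X hs,
    expSubst_X_subst hL] at h1
  have h2 : (1 : ℂ⟦X⟧).subst L = 1 := by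
    rw [← PowerSeries.coe_substAlgHom hs, map_one]
  rw [h2] at h1
  rw [h1, PowerSeries.coe_mul, mul_zpow]
  congr 1
  have h3 := coe_units_zpow ((HahnSeries.ofPowerSeries ℤ ℂ).comp
    (PowerSeries.substAlgHom (R := ℂ) hs : ℂ⟦X⟧ →+* ℂ⟦X⟧)) G m
  simpa [PowerSeries.coe_substAlgHom hs] using h3

/-- The binomial coefficient `N (N - 1) ⋯ (N - k + 1) / k!`, which is zero for negative `k`. -/
def intChoose (N k : ℤ) : ℂ := if 0 ≤ k then ((Ring.choose N k.toNat : ℤ) : ℂ) else 0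

theorem intChoose_natCast (N : ℤ) (k : ℕ) : intChoose N k = (Ring.choose N k : ℤ) := by
  simp [intChoose]

theorem intChoose_of_neg (N : ℤ) {k : ℤ} (h : k < 0) : intChoose N k = 0 := by
  simp [intChoose, h]

theorem intChoose_zero (N : ℤ) : intChoose N 0 = 1 := by
  simp [intChoose]

theorem intChoose_succ (N k : ℤ) :
    intChoose (N + 1) k = intChoose N k + intChoose N (k - 1) := by
  rcases lt_trichotomy k 0 with h | rfl | h
  · rw [intChoose_of_neg _ h, intChoose_of_neg _ h, intChoose_of_neg _ (by omega), add_zero]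
  · rw [intChoose_zero, intChoose_zero, intChoose_of_neg _ (by omega), add_zero]
  · obtain ⟨n, rfl⟩ : ∃ n : ℕ, k = n + 1 := ⟨(k - 1).toNat, by omega⟩
    rw [add_sub_cancel_right, ← Nat.cast_succ, intChoose_natCast, intChoose_natCast,
      intChoose_natCast, Nat.succ_eq_add_one, Ring.choose_succ_succ]
    push_cast
    ring

theorem intChoose_zero_left {k : ℤ} (h : k ≠ 0) : intChoose 0 k = 0 := by
  rcases lt_or_gt_of_ne h with h | h
  · exact intChoose_of_neg _ h
  · obtain ⟨n, rfl⟩ : ∃ n : ℕ, k = (n + 1 : ℕ) := ⟨(k - 1).toNat, by omega⟩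
    rw [intChoose_natCast, Ring.choose_zero_succ, Int.cast_zero]

/-- Here `e^L = 1 + z`, so the series is `(1+z)^N z^m`. -/
theorem coeff_expLaurent_log (N m q : ℤ) :
    (expLaurent logOnePlus N m).coeff q = intChoose N (q - m) := by
  rw [expLaurent, logOnePlus, expSubst_log_one, add_sub_cancel_left, PowerSeries.coe_X,
    ← RatFunc.single_zpow, mul_comm, HahnSeries.coeff_single_mul, one_mul, PowerSeries.coeff_coe,
    intChoose]
  by_cases h : q - m < 0
  · rw [if_pos h, if_neg (by omega)]
  · rw [if_neg h, if_pos (by omega), expSubst_log_intCast, PowerSeries.binomialSeries_coeff]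
    rw [show (q - m).toNat = (q - m).natAbs by omega]
    simp

/-- `Res_y e^{N y} (e^y - 1)^m`. -/
theorem coeff_neg_one_expLaurent_X (N m : ℤ) :
    (expLaurent PowerSeries.X N m).coeff (-1) = intChoose (N - 1) (-1 - m) := by
  have hX : PowerSeries.constantCoeff (PowerSeries.X : ℂ⟦X⟧) = 0 := PowerSeries.constantCoeff_X
  obtain ⟨G, hG⟩ := exists_exp_sub_one_eq
  have hne : ((expSubst PowerSeries.X 1 - 1 : ℂ⟦X⟧) : LaurentSeries ℂ) ≠ 0 := by
    intro h0
    have : expSubst PowerSeries.X 1 - 1 = 0 :=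
      HahnSeries.ofPowerSeries_injective (by rw [h0, map_zero])
    rw [hG] at this
    exact mul_ne_zero PowerSeries.X_ne_zero G.ne_zero this
  -- From `e^{(N+1)y} = e^{Ny} + e^{Ny}(e^y-1)`; this mirrors Pascal's rule for the binomials.
  have hpascal : ∀ N m : ℤ, (expLaurent PowerSeries.X ((N + 1 : ℤ) : ℚ) m).coeff (-1)
      = (expLaurent PowerSeries.X N m).coeff (-1)
        + (expLaurent PowerSeries.X N (m + 1)).coeff (-1) := by
    intro N m
    rw [← HahnSeries.coeff_add, expLaurent, expLaurent, expLaurent, Int.cast_add, Int.cast_one,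
      expSubst_add hX, zpow_add_one₀ hne, PowerSeries.coe_mul, PowerSeries.coe_sub,
      PowerSeries.coe_one]
    congr 1
    ring
  -- For `m ≠ -1`, `e^y (e^y-1)^m` is the derivative of `(e^y-1)^{m+1}/(m+1)` and has no residue.
  -- The argument below is this one, written with power series.
  have hbase : ∀ m : ℤ, (expLaurent PowerSeries.X ((1 : ℤ) : ℚ) m).coeff (-1)
      = intChoose (1 - 1) (-1 - m) := by
    intro m
    rw [sub_self]
    rcases lt_or_ge (-1) m with h | h
    · rw [coeff_expLaurent_X_eq_zero _ h, intChoose_of_neg _ (by omega)]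
    · obtain ⟨n, rfl⟩ : ∃ n : ℕ, m = -(n + 1 : ℕ) := ⟨(-1 - m).toNat, by omega⟩
      rw [expLaurent_X_eq hG, Int.cast_one, zpow_neg, zpow_natCast,
        show (-1 : ℤ) = -(n + 1 : ℕ) + (n : ℕ) by push_cast; ring, coeff_single_mul_coe]
      set H : ℂ⟦X⟧ := ((G⁻¹ : (ℂ⟦X⟧)ˣ) : ℂ⟦X⟧) with hH
      have hGH : (G : ℂ⟦X⟧) * H = 1 := by rw [hH]; simp
      have hcoe : (((G ^ (n + 1))⁻¹ : (ℂ⟦X⟧)ˣ) : ℂ⟦X⟧) = H ^ (n + 1) := by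
        rw [← inv_pow, Units.val_pow_eq_pow_val]
      rw [hcoe]
      have hE : expSubst PowerSeries.X 1
          = (G : ℂ⟦X⟧) + PowerSeries.X * PowerSeries.derivative ℂ (G : ℂ⟦X⟧) := by
        have h1 := congrArg (PowerSeries.derivative ℂ) hG
        rw [map_sub, expSubst_X_one, PowerSeries.derivative_exp, Derivation.map_one_eq_zero,
          sub_zero, Derivation.leibniz, PowerSeries.derivative_X] at h1
        rw [expSubst_X_one, h1]
        simp [add_comm]
      have hdH : PowerSeries.derivative ℂ H = -(H ^ 2 * PowerSeries.derivative ℂ (G : ℂ⟦X⟧)) := by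
        have h1 := congrArg (PowerSeries.derivative ℂ) hGH
        rw [Derivation.leibniz, Derivation.map_one_eq_zero, smul_eq_mul, smul_eq_mul] at h1
        linear_combination H * h1 - PowerSeries.derivative ℂ H * hGH
      rcases Nat.eq_zero_or_pos n with rfl | hn
      · rw [hE, add_mul, zero_add, pow_one, hGH, map_add, mul_assoc]
        simp [intChoose_zero]
      · rw [show -(((n + 1 : ℕ) : ℤ)) + n - -(((n + 1 : ℕ) : ℤ)) = n by ring,
          intChoose_zero_left (by omega)]
        -- With `e^y - 1 = yG` and `H = G⁻¹` one has `e^y = G + yG'`. In degree `n` the two terms on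
        -- the right cancel, each being `n` times the coefficient of `H^n`.
        have h1 : (n : ℂ⟦X⟧) * (expSubst PowerSeries.X 1 * H ^ (n + 1))
            = (n : ℂ⟦X⟧) * H ^ n - PowerSeries.X * PowerSeries.derivative ℂ (H ^ n) := by
          rw [Derivation.leibniz_pow, hdH, hE]
          obtain ⟨k, rfl⟩ : ∃ k, n = k + 1 := ⟨n - 1, by omega⟩
          simp only [add_tsub_cancel_right, smul_eq_mul, nsmul_eq_mul]
          linear_combination (((k + 1 : ℕ) : ℂ⟦X⟧) * H ^ (k + 1)) * hGH
        have h2 := congrArg (PowerSeries.coeff n) h1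
        obtain ⟨k, rfl⟩ : ∃ k, n = k + 1 := ⟨n - 1, by omega⟩
        rw [map_sub, PowerSeries.coeff_succ_X_mul, PowerSeries.coeff_derivative,
          ← nsmul_eq_mul, ← nsmul_eq_mul, map_nsmul, map_nsmul, nsmul_eq_mul, nsmul_eq_mul] at h2
        have h3 : ((k + 1 : ℕ) : ℂ) * PowerSeries.coeff (k + 1)
            (expSubst PowerSeries.X 1 * H ^ (k + 1 + 1)) = 0 := by
          rw [h2]; push_cast; ring
        exact (mul_eq_zero.mp h3).resolve_left (by exact_mod_cast Nat.succ_ne_zero k)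
  have key : ∀ j : ℕ, ∀ N : ℤ, (expLaurent PowerSeries.X N (-j : ℤ)).coeff (-1)
      = intChoose (N - 1) (-1 - (-j : ℤ)) := by
    intro j
    induction j with
    | zero =>
      intro N
      rw [coeff_expLaurent_X_eq_zero _ (by simp), intChoose_of_neg _ (by simp)]
    | succ j ih =>
      intro N
      have hj : (-((j + 1 : ℕ) : ℤ)) + 1 = -(j : ℤ) := by push_cast; ring
      have hstep : ∀ N : ℤ, intChoose (N + 1 - 1) (-1 - -((j + 1 : ℕ) : ℤ))
          = intChoose (N - 1) (-1 - -((j + 1 : ℕ) : ℤ)) + intChoose (N - 1) (-1 - -(j : ℤ)) := by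
        intro N
        rw [show N + 1 - 1 = (N - 1) + 1 by ring, intChoose_succ]
        congr 2
        push_cast; ring
      -- For a fixed pole order, Pascal's rule moves `N` both up and down from the base `N = 1`; its
      -- correction term has a smaller pole order and is known by `ih`.
      induction N using Int.inductionOn' (b := 1) with
      | zero => exact hbase _
      | succ k _ hk => rw [hpascal, hk, hj, ih, hstep]
      | pred k _ hk =>
        have h1 := hpascal (k - 1) (-((j + 1 : ℕ) : ℤ))
        have h2 := hstep (k - 1)
        rw [hj, ih, sub_add_cancel, hk] at h1
        rw [sub_add_cancel] at h2
        rw [h2] at h1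
        exact (add_right_cancel h1).symm
  rcases lt_or_ge 0 m with h | h
  · rw [coeff_expLaurent_X_eq_zero _ (by omega), intChoose_of_neg _ (by omega)]
  · obtain ⟨j, rfl⟩ : ∃ j : ℕ, m = -j := ⟨(-m).toNat, by omega⟩
    exact key j N

/-! ### Finite sums and products of formal series -/

section

variable {M : Type*} [AddCommGroup M] [Module ℂ M]

/-- Finiteness is required of the joint support: finite fibres alone do not justify interchanging
the two sums. -/
theorem finsum_prod_smul {ι : Type*} (c : ι → ℤ → ℂ) (ξ : ℤ → M)
    (h : {p : ι × ℤ | c p.1 p.2 ≠ 0 ∧ ξ p.2 ≠ 0}.Finite) :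
    ∑ᶠ p : ι × ℤ, c p.1 p.2 • ξ p.2 = ∑ᶠ m : ℤ, (∑ᶠ i : ι, c i m) • ξ m := by
  rw [← finsum_comp_equiv (Equiv.prodComm ℤ ι), finsum_curry]
  · exact finsum_congr fun m => (finsum_smul (fun i => c i m) (ξ m)).symm
  · refine (h.image Prod.swap).subset ?_
    rintro ⟨m, i⟩ hp
    rw [Function.mem_support] at hp
    exact ⟨(i, m), ⟨left_ne_zero_of_smul hp, right_ne_zero_of_smul hp⟩, rfl⟩

theorem finsum_smul_finsum_smul {ι : Type*} (a : ι → ℂ) (b : ι → ℤ → ℂ) (ξ : ℤ → M)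
    (h : {p : ι × ℤ | a p.1 * b p.1 p.2 ≠ 0 ∧ ξ p.2 ≠ 0}.Finite) :
    ∑ᶠ i : ι, a i • ∑ᶠ m : ℤ, b i m • ξ m = ∑ᶠ m : ℤ, (∑ᶠ i : ι, a i * b i m) • ξ m := by
  rw [← finsum_prod_smul _ _ h, finsum_curry]
  · refine finsum_congr fun i => ?_
    rw [smul_finsum]
    exact finsum_congr fun m => smul_smul _ _ _
  · refine h.subset fun p hp => ?_
    exact ⟨left_ne_zero_of_smul hp, right_ne_zero_of_smul hp⟩

theorem finsum_eq_finsum_comp {α β N : Type*} [AddCommMonoid N] (f : α → N) {i : β → α}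
    (hi : Function.Injective i) (h : ∀ a, (∀ b, i b ≠ a) → f a = 0) :
    ∑ᶠ a, f a = ∑ᶠ b, f (i b) := by
  rw [← finsum_mem_range hi]
  refine finsum_congr fun a => ?_
  by_cases ha : a ∈ Set.range i
  · simp [ha]
  · rw [h a fun b hb => ha ⟨b, hb⟩]
    simp

variable {ι Γ : Type*}

theorem formalSum_apply {N : Type*} [AddCommMonoid N] (c : ι → N) {e : ι → Γ}
    (he : Function.Injective e) (p : ι) : formalSum c e (e p) = c p := by
  rw [formalSum, finsum_eq_single _ p]
  · simp
  · intro q hq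
    have : e q ≠ e p := fun h => hq (he h)
    simp [this]

theorem formalSum_eq_zero {N : Type*} [AddCommMonoid N] (c : ι → N) {e : ι → Γ} {a : Γ}
    (h : ∀ p, e p ≠ a) : formalSum c e a = 0 := by
  simp [formalSum, h]

variable [AddCommGroup Γ]

/-- Injectivity of the exponents means that no two terms of the series collide, so the product can
be summed over the index set. -/
theorem formalMul_formalSum (c : ι → ℂ) {e : ι → Γ} (he : Function.Injective e) (g : Γ → M)
    (a : Γ) : formalMul (formalSum c e) g a = ∑ᶠ p : ι, c p • g (a - e p) := by
  rw [formalMul, finsum_eq_finsum_comp _ he]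
  · simp only [formalSum_apply c he]
  · intro b hb
    rw [formalSum_eq_zero c hb, zero_smul]

theorem mulExists_formalSum (c : ι → ℂ) (e : ι → Γ) (g : Γ → M)
    (h : ∀ a, {p : ι | g (a - e p) ≠ 0}.Finite) : MulExists (formalSum c e) g := by
  intro a
  refine ((h a).image e).subset fun b hb => ?_
  change formalSum c e b • g (a - b) ≠ 0 at hb
  by_cases hr : ∃ p, e p = b
  · obtain ⟨p, rfl⟩ := hr
    exact ⟨p, right_ne_zero_of_smul hb, rfl⟩
  · push Not at hr
    rw [formalSum_eq_zero c hr, zero_smul] at hb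
    exact absurd rfl hb

/-- The embedding of `ℤ³` in `ℚ³`. -/
def castTriple : ℤ × ℤ × ℤ →+ ℚ × ℚ × ℚ where
  toFun x := (x.1, x.2.1, x.2.2)
  map_zero' := by simp
  map_add' x y := by simp

theorem castTriple_apply (x : ℤ × ℤ × ℤ) : castTriple x = ((x.1 : ℚ), (x.2.1 : ℚ), (x.2.2 : ℚ)) :=
  rfl

theorem castTriple_injective : Function.Injective castTriple := by
  rintro ⟨a, b, c⟩ ⟨a', b', c'⟩ h
  simpa [castTriple_apply] using h

/-- A product with a series with exponents in `κ + ℤ³`, in terms of a product of series with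
integral exponents. -/
theorem formalMul_castTriple (c : ι → ℂ) {e' : ι → ℤ × ℤ × ℤ} (he' : Function.Injective e')
    {e : ι → ℚ × ℚ × ℚ} (t : ℤ × ℤ × ℤ) (he : ∀ p, e p = castTriple (e' p + t))
    (κ : ℚ × ℚ × ℚ) {g : ℚ × ℚ × ℚ → M} {g' : ℤ × ℤ × ℤ → M}
    (hg : ∀ x, g (κ + castTriple x) = g' x) (x : ℤ × ℤ × ℤ) :
    formalMul (formalSum c e) g (κ + castTriple (x + t)) = formalMul (formalSum c e') g' x := by
  have hinj : Function.Injective e := fun p q h =>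
    he' (add_right_cancel (castTriple_injective ((he p).symm.trans (h.trans (he q)))))
  rw [formalMul_formalSum c hinj, formalMul_formalSum c he']
  refine finsum_congr fun p => ?_
  rw [he, add_sub_assoc, ← map_sub, hg, add_sub_add_right_eq_sub]

/-- Multiplication by a series with integral exponents preserves support in the coset `κ + ℤ³`. -/
theorem formalMul_castTriple_eq_zero (c : ι → ℂ) {e : ι → ℚ × ℚ × ℚ}
    (hinj : Function.Injective e) (e' : ι → ℤ × ℤ × ℤ) (he : ∀ p, e p = castTriple (e' p))
    (κ : ℚ × ℚ × ℚ) {g : ℚ × ℚ × ℚ → M}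
    (hg : ∀ a, (∀ x, a ≠ κ + castTriple x) → g a = 0) {a : ℚ × ℚ × ℚ}
    (ha : ∀ x, a ≠ κ + castTriple x) : formalMul (formalSum c e) g a = 0 := by
  rw [formalMul_formalSum c hinj]
  refine finsum_eq_zero_of_forall_eq_zero fun p => ?_
  rw [hg, smul_zero]
  intro x hx
  apply ha (x + e' p)
  rw [map_add, ← he, ← add_assoc, ← hx, sub_add_cancel]

end

/-- The value of `f` at a rational number, zero if it is not an integer. -/
def evalInt {M : Type*} [Zero M] (f : ℤ → M) (a : ℚ) : M := if a.den = 1 then f a.num else 0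

theorem evalInt_intCast {M : Type*} [Zero M] (f : ℤ → M) (n : ℤ) : evalInt f n = f n := by
  simp [evalInt]

theorem evalInt_of_eq {M : Type*} [Zero M] (f : ℤ → M) {a : ℚ} {n : ℤ} (h : a = n) :
    evalInt f a = f n := by
  rw [h, evalInt_intCast]

theorem evalInt_eq_zero {M : Type*} [Zero M] (f : ℤ → M) {a : ℚ} (h : ∀ n : ℤ, a ≠ n) :
    evalInt f a = 0 := by
  rw [evalInt, if_neg]
  intro hd
  exact h a.num (Rat.den_eq_one_iff a |>.mp hd).symm

theorem evalInt_zero {M : Type*} [Zero M] (a : ℚ) : evalInt (fun _ => (0 : M)) a = 0 := by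
  simp [evalInt]

theorem evalInt_add {M : Type*} [AddCommMonoid M] (f g : ℤ → M) (a : ℚ) :
    evalInt (fun n => f n + g n) a = evalInt f a + evalInt g a := by
  unfold evalInt; split_ifs <;> simp

theorem evalInt_smul {M : Type*} [AddCommGroup M] [Module ℂ M] (r : ℂ) (f : ℤ → M) (a : ℚ) :
    evalInt (fun n => r • f n) a = r • evalInt f a := by
  unfold evalInt; split_ifs <;> simp

/-! ### Injectivity of exponent maps -/

theorem expDelta_exponent_injective (r s : ℚ) :
    Function.Injective
      (fun p : ℤ × ℕ => ((p.1 : ℚ) + r) • ((0, -1, 1) : ℚ × ℚ × ℚ) + (p.2 : ℚ) • (1, 0, s)) := by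
  rintro ⟨n, j⟩ ⟨n', j'⟩ h
  simp only [Prod.smul_mk, Prod.mk_add_mk, Prod.mk.injEq, smul_eq_mul] at h
  obtain ⟨h1, h2, -⟩ := h
  have h3 : (j : ℚ) = j' := by linarith
  have h4 : (n : ℚ) = n' := by linarith
  simp only [Prod.mk.injEq]
  exact ⟨by exact_mod_cast h4, by exact_mod_cast h3⟩

end FormalCalculus

namespace VertexOperatorSuperalgebra

variable {V : Type*} [AddCommGroup V] [Module ℂ V] (S : VertexOperatorSuperalgebra V)

/-! ### Modes, homogeneous components and the series `X(u, x)` -/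

/-- The coefficient of `x^n` in `Y(u, x) w`, as a bilinear map. -/
def mode (n : ℤ) : V →ₗ[ℂ] V →ₗ[ℂ] V where
  toFun u := HVertexOperator.coeff (S.Y u) n
  map_add' u u' := by rw [map_add, map_add, Pi.add_apply]
  map_smul' r u := by rw [map_smul, map_smul, Pi.smul_apply, RingHom.id_apply]

theorem coeff_eq_mode (u w : V) (n : ℤ) :
    HVertexOperator.coeff (S.Y u) n w = S.mode n u w := rfl

theorem exists_mode_eq_zero (u w : V) : ∃ K : ℤ, ∀ n < K, S.mode n u w = 0 :=
  ⟨_, fun n hn => VertexOperator.coeff_eq_zero_of_lt_order (S.Y u) n w hn⟩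

theorem component_of_mem {k : ℤ} {u : V} (hu : u ∈ S.deg k) : S.component k u = u := by
  let _ := S.deg_internal.chooseDecomposition
  exact DirectSum.decompose_of_mem_same S.deg hu

theorem component_of_mem_ne {k l : ℤ} {u : V} (hu : u ∈ S.deg k) (h : k ≠ l) :
    S.component l u = 0 := by
  let _ := S.deg_internal.chooseDecomposition
  exact DirectSum.decompose_of_mem_ne S.deg hu h

theorem component_mem (k : ℤ) (u : V) : S.component k u ∈ S.deg k := by
  let _ := S.deg_internal.chooseDecomposition
  exact SetLike.coe_mem (DirectSum.decompose S.deg u k)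

theorem component_add (k : ℤ) (u v : V) :
    S.component k (u + v) = S.component k u + S.component k v := by
  let _ := S.deg_internal.chooseDecomposition
  simp [component, DirectSum.decompose_add]

theorem component_smul (k : ℤ) (r : ℂ) (u : V) :
    S.component k (r • u) = r • S.component k u := by
  let _ := S.deg_internal.chooseDecomposition
  simp only [component, DirectSum.decompose_smul]
  rfl

theorem finite_component_ne_zero (u : V) : {k : ℤ | S.component k u ≠ 0}.Finite := by
  let _ := S.deg_internal.chooseDecomposition
  classical
  refine ((DirectSum.decompose S.deg u).support.finite_toSet).subset fun k hk => ?_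
  rw [Finset.mem_coe, DFinsupp.mem_support_iff]
  intro h
  apply hk
  change ((DirectSum.decompose S.deg u) k : V) = 0
  rw [h]; rfl

/-- Induction on the homogeneous components of a vector. -/
theorem deg_induction {p : V → Prop} (hom : ∀ k, ∀ u ∈ S.deg k, p u)
    (add : ∀ u v, p u → p v → p (u + v)) (u : V) : p u := by
  have h : u ∈ ⨆ k, S.deg k := by
    rw [S.deg_internal.submodule_iSup_eq_top]
    exact Submodule.mem_top
  exact Submodule.iSup_induction S.deg (motive := p) h hom (hom 0 0 (zero_mem _)) add

/-- For each `k` at most one integer `n` satisfies `k/2 + n = a`, so the double sum collapses to a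
sum over degrees. -/
theorem X_eq (u w : V) (a : ℚ) :
    S.X u w a = ∑ᶠ k : ℤ, evalInt (fun n => S.mode n (S.component k u) w) (a - (k : ℚ) / 2) := by
  simp only [X, formalSum, coeff_eq_mode, finsum_eq_if]
  rw [finsum_curry]
  · refine finsum_congr fun k => ?_
    by_cases h : ∃ n : ℤ, a - (k : ℚ) / 2 = n
    · obtain ⟨n, hn⟩ := h
      rw [evalInt_of_eq _ hn, finsum_eq_single _ n]
      · exact if_pos (by linarith)
      · intro m hm
        refine if_neg fun h => hm ?_
        have : (m : ℚ) = n := by linarith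
        exact_mod_cast this
    · push Not at h
      rw [evalInt_eq_zero _ h]
      exact finsum_eq_zero_of_forall_eq_zero fun m => if_neg fun hm => h m (by linarith)
  · refine ((S.finite_component_ne_zero u).image fun k : ℤ => (k, (a - (k : ℚ) / 2).num)).subset ?_
    rintro ⟨k, n⟩ hp
    rw [Function.mem_support, ne_eq, ite_eq_right_iff, Classical.not_imp] at hp
    refine ⟨k, ?_, ?_⟩
    · intro h0
      exact hp.2 (by rw [h0, map_zero, LinearMap.zero_apply])
    · have : a - (k : ℚ) / 2 = (n : ℚ) := by linarith [hp.1]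
      simp [this]

theorem finite_X_support (u w : V) (a : ℚ) : (Function.support fun k : ℤ =>
    evalInt (fun n => S.mode n (S.component k u) w) (a - (k : ℚ) / 2)).Finite := by
  refine (S.finite_component_ne_zero u).subset fun k hk => ?_
  intro h
  apply hk
  simp [h, evalInt_zero]

/-- The coefficient of `x^a` in `X(u, x) w`, as a bilinear map. -/
def modeX (a : ℚ) : V →ₗ[ℂ] V →ₗ[ℂ] V :=
  LinearMap.mk₂ ℂ (fun u w => S.X u w a)
    (fun u u' w => by
      simp only [X_eq]
      rw [← finsum_add_distrib (S.finite_X_support u w a) (S.finite_X_support u' w a)]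
      refine finsum_congr fun k => ?_
      rw [← evalInt_add]
      simp only [component_add, map_add, LinearMap.add_apply])
    (fun r u w => by
      simp only [X_eq]
      rw [smul_finsum]
      refine finsum_congr fun k => ?_
      rw [← evalInt_smul]
      simp only [component_smul, map_smul, LinearMap.smul_apply])
    (fun u w w' => by
      simp only [X_eq]
      rw [← finsum_add_distrib (S.finite_X_support u w a) (S.finite_X_support u w' a)]
      refine finsum_congr fun k => ?_
      rw [← evalInt_add]
      simp only [map_add])
    (fun r u w => by
      simp only [X_eq]
      rw [smul_finsum]
      refine finsum_congr fun k => ?_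
      rw [← evalInt_smul]
      simp only [map_smul])

theorem X_eq_modeX (u w : V) (a : ℚ) : S.X u w a = S.modeX a u w := rfl

theorem modeX_of_mem {k : ℤ} {u : V} (hu : u ∈ S.deg k) (w : V) (a : ℚ) :
    S.modeX a u w = evalInt (fun n => S.mode n u w) (a - (k : ℚ) / 2) := by
  rw [← X_eq_modeX, X_eq, finsum_eq_single _ k]
  · rw [S.component_of_mem hu]
  · intro l hl
    rw [S.component_of_mem_ne hu hl.symm]
    simp [evalInt_zero]

theorem exists_modeX_eq_zero (u w : V) : ∃ K : ℚ, ∀ a < K, S.modeX a u w = 0 := by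
  revert u
  refine S.deg_induction (fun k u hu => ?_) (fun u v hu hv => ?_)
  · obtain ⟨K, hK⟩ := S.exists_mode_eq_zero u w
    refine ⟨K + (k : ℚ) / 2, fun a ha => ?_⟩
    rw [S.modeX_of_mem hu]
    by_cases h : ∃ n : ℤ, a - (k : ℚ) / 2 = n
    · obtain ⟨n, hn⟩ := h
      rw [evalInt_of_eq _ hn, hK]
      have : (n : ℚ) < K := by linarith
      exact_mod_cast this
    · push Not at h
      exact evalInt_eq_zero _ h
  · obtain ⟨K, hK⟩ := hu
    obtain ⟨K', hK'⟩ := hv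
    refine ⟨min K K', fun a ha => ?_⟩
    rw [map_add, LinearMap.add_apply, hK a (ha.trans_le (min_le_left _ _)),
      hK' a (ha.trans_le (min_le_right _ _)), add_zero]

/-! ### The Jacobi identity in coefficients -/

/-- The coefficients of `Y(u, x₁) Y(v, x₂) w`, as a series in `x₀, x₁, x₂`. -/
def leftSeries (u v w : V) : ℤ × ℤ × ℤ → V :=
  liftLastTwo fun a => HVertexOperator.coeff (S.Y u) a.1 (HVertexOperator.coeff (S.Y v) a.2 w)

/-- The coefficients of `Y(v, x₂) Y(u, x₁) w`, as a series in `x₀, x₁, x₂`. -/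
def rightSeries (u v w : V) : ℤ × ℤ × ℤ → V :=
  liftLastTwo fun a => HVertexOperator.coeff (S.Y v) a.2 (HVertexOperator.coeff (S.Y u) a.1 w)

/-- The coefficients of `Y(Y(u, x₀) v, x₂) w`, as a series in `x₀, x₁, x₂`. -/
def iterateSeries (u v w : V) : ℤ × ℤ × ℤ → V := fun a => if a.2.1 = 0 then
  HVertexOperator.coeff (S.Y (HVertexOperator.coeff (S.Y u) a.1 v)) a.2.2 w else 0

theorem left_exponent_injective : Function.Injective fun p : ℤ × ℕ =>
    (p.1 - (p.2 : ℤ)) • ((0, 1, 0) : ℤ × ℤ × ℤ) + (p.2 : ℤ) • (0, 0, 1) - (p.1 + 1) • (1, 0, 0) := by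
  rintro ⟨n, j⟩ ⟨n', j'⟩ h
  simp only [Prod.smul_mk, Prod.mk_add_mk, Prod.mk_sub_mk, Prod.mk.injEq, smul_eq_mul] at h ⊢
  omega

theorem right_exponent_injective : Function.Injective fun p : ℤ × ℕ =>
    (p.1 - (p.2 : ℤ)) • ((0, 0, 1) : ℤ × ℤ × ℤ) + (p.2 : ℤ) • (0, 1, 0) - (p.1 + 1) • (1, 0, 0) := by
  rintro ⟨n, j⟩ ⟨n', j'⟩ h
  simp only [Prod.smul_mk, Prod.mk_add_mk, Prod.mk_sub_mk, Prod.mk.injEq, smul_eq_mul] at h ⊢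
  omega

theorem iterate_exponent_injective : Function.Injective fun p : ℤ × ℕ =>
    (p.1 - (p.2 : ℤ)) • ((0, 1, 0) : ℤ × ℤ × ℤ) + (p.2 : ℤ) • (1, 0, 0) - (p.1 + 1) • (0, 0, 1) := by
  rintro ⟨n, j⟩ ⟨n', j'⟩ h
  simp only [Prod.smul_mk, Prod.mk_add_mk, Prod.mk_sub_mk, Prod.mk.injEq, smul_eq_mul] at h ⊢
  omega

/-- The exponent of `x₁` comes from the delta function alone and forces `n = x.2.1 + j`; the
remaining index is `m = x.1 - j`. -/
theorem formalMul_iterateSeries (u v w : V) (x : ℤ × ℤ × ℤ) :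
    formalMul (deltaSub 1 (0, 1, 0) (1, 0, 0) (0, 0, 1)) (S.iterateSeries u v w) x
      = ∑ᶠ m : ℤ, intChoose (-x.2.1 - 1) (x.1 - m) •
          S.mode (x.1 + x.2.1 + x.2.2 + 1 - m) (S.mode m u v) w := by
  obtain ⟨a, b, c⟩ := x
  rw [deltaSub, formalMul_formalSum _ iterate_exponent_injective]
  have hinj : Function.Injective fun j : ℕ => ((b + j, j) : ℤ × ℕ) := by
    intro j j' h
    simpa using congrArg Prod.snd h
  have hinj' : Function.Injective fun j : ℕ => (a - j : ℤ) := by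
    intro j j' h
    simpa using h
  rw [finsum_eq_finsum_comp _ hinj, finsum_eq_finsum_comp (α := ℤ) _ hinj']
  · refine finsum_congr fun j => ?_
    -- Negation of the upper index: `(-1)^j C(b+j, j) = C(-b-1, j)`.
    have h1 : intChoose (-b - 1) (a - (a - j)) = (-1) ^ j * ((Ring.choose (b + j) j : ℤ) : ℂ) := by
      rw [sub_sub_cancel, intChoose_natCast, show -b - 1 = -(b + 1) by ring, Ring.choose_neg,
        show b + 1 + j - 1 = b + j by ring, Units.smul_def]
      simp
    have h2 : (a, b, c) - ((b + j - (j : ℤ)) • ((0, 1, 0) : ℤ × ℤ × ℤ) + (j : ℤ) • (1, 0, 0)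
        - (b + j + 1) • (0, 0, 1)) = (a - j, 0, a + b + c + 1 - (a - j)) := by
      simp only [Prod.smul_mk, Prod.mk_add_mk, Prod.mk_sub_mk, smul_eq_mul, Prod.mk.injEq]
      refine ⟨by ring, by ring, by ring⟩
    rw [h1, h2]
    simp [iterateSeries, mode]
  · intro m hm
    rw [intChoose_of_neg, zero_smul]
    by_contra h
    exact hm (a - m).toNat (by omega)
  · rintro ⟨n, j⟩ hp
    rw [iterateSeries, if_neg, smul_zero]
    intro h
    simp only [Prod.smul_mk, Prod.mk_add_mk, Prod.mk_sub_mk, smul_eq_mul] at h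
    exact hp j (by rw [Prod.mk.injEq]; omega)

/-- The residue in `x₀` selects the term `n = 0` of the delta function, and `(x₁-x₂)^0 = 1`. -/
theorem formalMul_leftSeries (u v w : V) (b c : ℤ) :
    formalMul (deltaSub 1 (0, 1, 0) (0, 0, 1) (1, 0, 0)) (S.leftSeries u v w) (-1, b, c)
      = S.mode b u (S.mode c v w) := by
  rw [deltaSub, formalMul_formalSum _ left_exponent_injective, finsum_eq_single _ (0, 0)]
  · simp [leftSeries, liftLastTwo, mode]
  · rintro ⟨n, j⟩ hp
    by_cases hn : n = 0
    · subst hn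
      have hj : 0 < j := Nat.pos_of_ne_zero fun h => hp (by rw [h])
      simp [Ring.choose_zero_pos ℤ hj]
    · rw [leftSeries, liftLastTwo, if_neg, smul_zero]
      simp only [Prod.smul_mk, Prod.mk_add_mk, Prod.mk_sub_mk, smul_eq_mul]
      omega

theorem formalMul_rightSeries (u v w : V) (b c : ℤ) :
    formalMul (deltaSub (-1) (0, 0, 1) (0, 1, 0) (1, 0, 0)) (S.rightSeries u v w) (-1, b, c)
      = S.mode c v (S.mode b u w) := by
  rw [deltaSub, formalMul_formalSum _ right_exponent_injective, finsum_eq_single _ (0, 0)]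
  · simp [rightSeries, liftLastTwo, mode]
  · rintro ⟨n, j⟩ hp
    by_cases hn : n = 0
    · subst hn
      have hj : 0 < j := Nat.pos_of_ne_zero fun h => hp (by rw [h])
      simp [Ring.choose_zero_pos ℤ hj]
    · rw [rightSeries, liftLastTwo, if_neg, smul_zero]
      simp only [Prod.smul_mk, Prod.mk_add_mk, Prod.mk_sub_mk, smul_eq_mul]
      omega

/-- The residue in `x₀` of the Jacobi identity. -/
theorem mode_commutator {i j : ZMod 2} {u v : V} (hu : u ∈ S.par i) (hv : v ∈ S.par j) (w : V)
    (b c : ℤ) :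
    S.mode b u (S.mode c v w) - paritySign i j • S.mode c v (S.mode b u w)
      = ∑ᶠ m : ℤ, intChoose (-b - 1) (-1 - m) • S.mode (b + c - m) (S.mode m u v) w := by
  have h := congrFun (S.jacobi i j u v w hu hv) (-1, b, c)
  rw [Pi.sub_apply, Pi.smul_apply] at h
  rw [← formalMul_leftSeries, ← formalMul_rightSeries]
  refine h.trans ((S.formalMul_iterateSeries u v w (-1, b, c)).trans ?_)
  refine finsum_congr fun m => ?_
  rw [show -1 + b + c + 1 - m = b + c - m by ring]

/-! ### Modes and degree -/

/-- `L(0)` preserves components and acts on different degrees with different eigenvalues, so an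
eigenvector has only one component. -/
theorem deg_of_L_zero {k : ℤ} {u : V} (h : S.mode (-2) S.ω u = ((k : ℂ) / 2) • u) :
    u ∈ S.deg k := by
  have hL : ∀ l : ℤ, ∀ v : V, S.component l (S.mode (-2) S.ω v)
      = ((l : ℂ) / 2) • S.component l v := by
    intro l
    refine S.deg_induction (fun m v hv => ?_) (fun v v' hv hv' => ?_)
    · have := S.L_zero m v hv
      rw [virasoroMode, neg_zero, zero_sub, coeff_eq_mode] at this
      rw [this, component_smul]
      by_cases hml : m = l
      · rw [hml]
      · rw [S.component_of_mem_ne hv hml, smul_zero, smul_zero]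
    · rw [map_add, component_add, component_add, hv, hv', smul_add]
  have h0 : ∀ l : ℤ, l ≠ k → S.component l u = 0 := by
    intro l hl
    have h1 := hL l u
    rw [h, component_smul, ← sub_eq_zero, ← sub_smul] at h1
    refine (smul_eq_zero.mp h1).resolve_left fun hc => hl ?_
    have : (l : ℂ) = k := by linear_combination -2 * hc
    exact_mod_cast this
  let _ := S.deg_internal.chooseDecomposition
  classical
  rw [← DirectSum.sum_support_decompose S.deg u]
  refine sum_mem fun l _ => ?_
  by_cases hl : l = k
  · rw [hl]; exact S.component_mem k u
  · have : ((DirectSum.decompose S.deg u) l : V) = 0 := h0 l hl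
    rw [this]; exact zero_mem _

/-- In the commutator formula with `ω` the binomial is `C(1, -1-m)`, so only `m = -1` and `m = -2`
survive. They carry `L(-1)u`, which is a derivative, and `L(0)u`. -/
theorem L_zero_commutator {i : ZMod 2} {u : V} (hu : u ∈ S.par i) (w : V) (n : ℤ) :
    S.mode (-2) S.ω (S.mode n u w) - S.mode n u (S.mode (-2) S.ω w)
      = (n : ℂ) • S.mode n u w + S.mode n (S.mode (-2) S.ω u) w := by
  have h := S.mode_commutator S.ω_par hu w (-2) n
  have hsign : paritySign 0 i = 1 := by simp [paritySign]
  rw [hsign, one_smul] at h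
  rw [h, finsum_eq_sum_of_support_subset (s := {-1, -2})]
  · have h1 := congrArg (fun f => f w) (S.L_neg_one u (n - 1))
    simp only [virasoroMode, coeff_eq_mode, LinearMap.smul_apply, sub_add_cancel] at h1
    rw [show (-(-1) - 2 : ℤ) = -1 by norm_num] at h1
    rw [Finset.sum_pair (by norm_num), show (-2 + n - -1 : ℤ) = n - 1 by ring, h1,
      show (-2 + n - -2 : ℤ) = n by ring]
    norm_num [intChoose]
  · intro m hm
    simp only [Finset.coe_insert, Finset.coe_singleton, Set.mem_insert_iff, Set.mem_singleton_iff]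
    by_contra hc
    push Not at hc
    apply hm
    have hz : intChoose (- -2 - 1) (-1 - m) = 0 := by
      rw [show (- -2 - 1 : ℤ) = 0 + 1 by norm_num, intChoose_succ, intChoose_zero_left (by omega),
        intChoose_zero_left (by omega), add_zero]
    simp only [hz, zero_smul]

/-- By the commutator with `L(0)`, the vector is an `L(0)`-eigenvector with eigenvalue `k/2 + l/2 +
n`. The index counts half-units, hence `2 * n`. -/
theorem mode_mem_deg {k l : ℤ} {i : ZMod 2} {u v : V} (hu : u ∈ S.deg k) (hi : u ∈ S.par i)
    (hv : v ∈ S.deg l) (n : ℤ) : S.mode n u v ∈ S.deg (k + l + 2 * n) := by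
  apply S.deg_of_L_zero
  have h := S.L_zero_commutator hi v n
  have h1 := S.L_zero k u hu
  have h2 := S.L_zero l v hv
  rw [virasoroMode, neg_zero, zero_sub, coeff_eq_mode] at h1 h2
  rw [h1, h2, map_smul, map_smul, LinearMap.smul_apply, sub_eq_iff_eq_add] at h
  rw [h, ← add_smul, ← add_smul]
  congr 1
  push_cast
  ring

/-! ### The coefficients of `Y[u, y] v` -/

theorem coeff_expSubOne_zpow_eq_zero {n q : ℤ} (h : q < n) : (expSubOne ^ n).coeff q = 0 := by
  obtain ⟨G, hG⟩ := exists_exp_sub_one_eq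
  rw [expSubOne_eq, hG, coe_X_mul_zpow, coeff_coe_mul_eq_zero h]

theorem L_zero_pow_of_mem {k : ℤ} {u : V} (hu : u ∈ S.deg k) (i : ℕ) :
    (virasoroMode S.Y S.ω 0 ^ i) u = ((k : ℂ) / 2) ^ i • u := by
  induction i with
  | zero => simp
  | succ i ih => rw [pow_succ', Module.End.mul_apply, ih, map_smul, S.L_zero k u hu, smul_smul, pow_succ]

/-- The truncation bound must be uniform in `i`; it is, because on each homogeneous component
`L(0)^i` is a scalar. -/
theorem exists_mode_L_zero_pow_eq_zero (u v : V) :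
    ∃ K : ℤ, ∀ (i : ℕ), ∀ n < K, S.mode n ((virasoroMode S.Y S.ω 0 ^ i) u) v = 0 := by
  revert u
  refine S.deg_induction (fun k u hu => ?_) (fun u u' hu hu' => ?_)
  · obtain ⟨K, hK⟩ := S.exists_mode_eq_zero u v
    refine ⟨K, fun i n hn => ?_⟩
    rw [S.L_zero_pow_of_mem hu, map_smul, LinearMap.smul_apply, hK n hn, smul_zero]
  · obtain ⟨K, hK⟩ := hu
    obtain ⟨K', hK'⟩ := hu'
    refine ⟨min K K', fun i n hn => ?_⟩
    rw [map_add, map_add, LinearMap.add_apply, hK i n (hn.trans_le (min_le_left _ _)),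
      hK' i n (hn.trans_le (min_le_right _ _)), add_zero]

theorem bracket_eq (u v : V) (k : ℤ) : S.bracket u v k = ∑ᶠ p : ℕ × ℤ,
    (((p.1.factorial : ℂ))⁻¹ * (expSubOne ^ p.2).coeff (k - p.1)) •
      S.mode p.2 ((virasoroMode S.Y S.ω 0 ^ p.1) u) v := rfl

theorem finite_box (K k : ℤ) : {p : ℕ × ℤ | K ≤ p.2 ∧ p.2 ≤ k - p.1}.Finite := by
  refine ((Set.finite_Iic (k - K).toNat).prod (Set.finite_Icc K k)).subset ?_
  rintro ⟨i, n⟩ ⟨h1, h2⟩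
  dsimp only at h1 h2
  refine Set.mk_mem_prod (Set.mem_Iic.mpr ?_) (Set.mem_Icc.mpr ⟨h1, ?_⟩) <;> omega

theorem bracket_term_support {u v : V} {K : ℤ}
    (hK : ∀ (i : ℕ), ∀ n < K, S.mode n ((virasoroMode S.Y S.ω 0 ^ i) u) v = 0) (k : ℤ) :
    (Function.support fun p : ℕ × ℤ =>
      (((p.1.factorial : ℂ))⁻¹ * (expSubOne ^ p.2).coeff (k - p.1)) •
        S.mode p.2 ((virasoroMode S.Y S.ω 0 ^ p.1) u) v) ⊆
      {p : ℕ × ℤ | K ≤ p.2 ∧ p.2 ≤ k - p.1} := by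
  rintro ⟨i, n⟩ hp
  rw [Function.mem_support] at hp
  constructor
  · by_contra h
    exact hp (by rw [hK i n (not_le.mp h), smul_zero])
  · by_contra h
    exact hp (by rw [coeff_expSubOne_zpow_eq_zero (not_le.mp h), mul_zero, zero_smul])

theorem finite_bracket_support (u v : V) (k : ℤ) :
    (Function.support fun p : ℕ × ℤ =>
      (((p.1.factorial : ℂ))⁻¹ * (expSubOne ^ p.2).coeff (k - p.1)) •
        S.mode p.2 ((virasoroMode S.Y S.ω 0 ^ p.1) u) v).Finite := by
  obtain ⟨K, hK⟩ := S.exists_mode_L_zero_pow_eq_zero u v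
  exact (finite_box K k).subset (S.bracket_term_support hK k)

theorem exists_bracket_eq_zero (u v : V) : ∃ K : ℤ, ∀ k < K, S.bracket u v k = 0 := by
  obtain ⟨K, hK⟩ := S.exists_mode_L_zero_pow_eq_zero u v
  refine ⟨K, fun k hk => ?_⟩
  rw [bracket_eq]
  refine finsum_eq_zero_of_forall_eq_zero fun p => ?_
  by_contra h
  have := S.bracket_term_support hK k (Function.mem_support.mpr h)
  obtain ⟨h1, h2⟩ := this
  omega

/-- The coefficient of `y^k` in `Y[u, y] v`, as a bilinear map. -/
def modeBracket (k : ℤ) : V →ₗ[ℂ] V →ₗ[ℂ] V :=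
  LinearMap.mk₂ ℂ (fun u v => S.bracket u v k)
    (fun u u' v => by
      simp only [bracket_eq]
      rw [← finsum_add_distrib (S.finite_bracket_support u v k) (S.finite_bracket_support u' v k)]
      refine finsum_congr fun p => ?_
      rw [map_add, map_add, LinearMap.add_apply, smul_add])
    (fun r u v => by
      simp only [bracket_eq]
      rw [smul_finsum]
      refine finsum_congr fun p => ?_
      rw [map_smul, map_smul, LinearMap.smul_apply, smul_comm])
    (fun u v v' => by
      simp only [bracket_eq]
      rw [← finsum_add_distrib (S.finite_bracket_support u v k) (S.finite_bracket_support u v' k)]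
      refine finsum_congr fun p => ?_
      rw [map_add, smul_add])
    (fun r u v => by
      simp only [bracket_eq]
      rw [smul_finsum]
      refine finsum_congr fun p => ?_
      rw [map_smul, smul_comm])

theorem bracket_eq_modeBracket (u v : V) (k : ℤ) : S.bracket u v k = S.modeBracket k u v := rfl

theorem coeff_expSubst_X (s : ℚ) (i : ℕ) :
    PowerSeries.coeff i (expSubst PowerSeries.X s) = (s : ℂ) ^ i * ((i.factorial : ℂ))⁻¹ := by
  rw [expSubst_eq_rescale PowerSeries.constantCoeff_X, PowerSeries.X_subst,
    PowerSeries.coeff_rescale, PowerSeries.coeff_exp]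
  simp

/-- On `u` the operator `e^{yL(0)}` is the scalar `e^{ky/2}`, so the sum over `i` is a Cauchy
product of scalar series. -/
theorem bracket_of_mem {k : ℤ} {u : V} (hu : u ∈ S.deg k) (v : V) (q : ℤ) :
    S.bracket u v q
      = ∑ᶠ m : ℤ, (expLaurent PowerSeries.X ((k : ℚ) / 2) m).coeff q • S.mode m u v := by
  obtain ⟨K, hK⟩ := S.exists_mode_eq_zero u v
  rw [bracket_eq]
  have h := finsum_prod_smul (fun (i : ℕ) (m : ℤ) =>
    PowerSeries.coeff i (expSubst PowerSeries.X ((k : ℚ) / 2)) * (expSubOne ^ m).coeff (q - i))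
    (fun m => S.mode m u v) ((finite_box K q).subset ?_)
  · simp only [← coeff_coe_mul] at h
    rw [expSubOne_eq] at h
    refine Eq.trans (finsum_congr fun p => ?_) h
    rw [S.L_zero_pow_of_mem hu, map_smul, LinearMap.smul_apply, smul_smul, coeff_expSubst_X,
      expSubOne_eq]
    push_cast
    congr 1
    ring
  · rintro ⟨i, m⟩ ⟨h1, h2⟩
    constructor
    · by_contra hc
      exact h2 (hK m (not_le.mp hc))
    · by_contra hc
      exact h1 (by dsimp only; rw [coeff_expSubOne_zpow_eq_zero (not_le.mp hc), mul_zero])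

/-! ### The series `X(Y[u, y] v, x₂)` and its product with a delta function -/

/-- The exponent of the first variable is the power of `z`, and `z` also carries `x₂^c`. The cases
used are `c = -1`, for `z = x₀/x₂`, and `c = 0`, for a formal variable `y`. -/
theorem XBracket_apply (L : ℂ⟦X⟧) (c : ℚ) (u v w : V) (a : ℚ × ℚ × ℚ) :
    S.XBracket L (1, 0, c) u v w a = if a.2.1 = 0 then
      evalInt (fun q : ℤ => ∑ᶠ p : ℤ, ((L : LaurentSeries ℂ) ^ p).coeff q •
        S.modeX (a.2.2 - c * a.1) (S.bracket u v p) w) a.1 else 0 := by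
  obtain ⟨a₀, a₁, a₂⟩ := a
  rw [XBracket]
  by_cases h : a₁ = 0 ∧ ∃ q : ℤ, a₀ = q
  · obtain ⟨rfl, q, rfl⟩ := h
    rw [if_pos rfl, evalInt_intCast, formalSum]
    have hinj : Function.Injective fun p : ℤ => ((p, q, a₂ - c * q) : ℤ × ℤ × ℚ) := by
      intro p p' h
      simpa using h
    rw [finsum_eq_finsum_comp _ hinj]
    · refine finsum_congr fun p => ?_
      rw [finsum_eq_if, if_pos]
      · rfl
      · simp [mul_comm c]
    · rintro ⟨p, q', s⟩ hp
      rw [finsum_eq_if, if_neg]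
      intro he
      simp only [Prod.smul_mk, Prod.mk_add_mk, Prod.mk.injEq, smul_eq_mul, mul_one, mul_zero,
        add_zero] at he
      obtain ⟨h1, -, h2⟩ := he
      have h3 : q' = q := by exact_mod_cast h1
      subst h3
      exact hp p (by rw [← h2]; simp [mul_comm c])
  · rw [formalSum_eq_zero]
    · split_ifs with h0
      · rw [evalInt_eq_zero]
        intro q hq
        exact h ⟨h0, q, hq⟩
      · rfl
    · rintro ⟨p, q, s⟩ he
      simp only [Prod.smul_mk, Prod.mk_add_mk, Prod.mk.injEq, smul_eq_mul, mul_one, mul_zero,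
        add_zero] at he
      exact h ⟨he.2.1.symm, q, he.1.symm⟩

/-- The exponent of `x₁` fixes `n`. Since `Y[u,y]v` is bounded below in `y` by some `K` and `L^p`
starts in degree `p`, the power `j` of `z` is at most `a.1 - K`. -/
theorem mulExists_XBracket {L : ℂ⟦X⟧} (hL : PowerSeries.constantCoeff L = 0)
    (hL1 : PowerSeries.coeff 1 L ≠ 0) (c r : ℚ) (u v w : V) :
    MulExists (expDelta L (1, 0, c) (0, -1, 1) r) (S.XBracket L (1, 0, c) u v w) := by
  obtain ⟨K, hK⟩ := S.exists_bracket_eq_zero u v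
  refine mulExists_formalSum _ _ _ fun a => ?_
  refine ((Set.finite_singleton (-a.2.1 - r).num).prod
    (Set.finite_Iic (⌈a.1 - K⌉).toNat)).subset ?_
  rintro ⟨n, j⟩ hp
  change S.XBracket _ _ _ _ _ _ ≠ 0 at hp
  rw [XBracket_apply] at hp
  obtain ⟨a₀, a₁, a₂⟩ := a
  simp only [Prod.smul_mk, Prod.mk_add_mk, Prod.mk_sub_mk, smul_eq_mul, mul_one, mul_zero,
    add_zero, zero_add, mul_neg, sub_neg_eq_add] at hp
  split_ifs at hp with h
  · have h1 : -a₁ - r = (n : ℚ) := by linarith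
    refine Set.mk_mem_prod (by simp [h1]) (Set.mem_Iic.mpr ?_)
    by_cases hq : ∃ q : ℤ, a₀ - j = q
    · obtain ⟨q, hq⟩ := hq
      rw [evalInt_of_eq _ hq] at hp
      have hKq : K ≤ q := by
        by_contra hc
        apply hp
        refine finsum_eq_zero_of_forall_eq_zero fun p => ?_
        rcases lt_or_ge p K with h2 | h2
        · rw [hK p h2, map_zero, LinearMap.zero_apply, smul_zero]
        · rw [coeff_zpow_eq_zero hL hL1 (by omega), zero_smul]
      have h2 : (j : ℚ) ≤ a₀ - K := by
        have : (K : ℚ) ≤ q := by exact_mod_cast hKq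
        linarith
      have h3 : ((j : ℤ) : ℚ) ≤ ⌈a₀ - K⌉ := by
        push_cast
        exact h2.trans (Int.le_ceil _)
      have h4 : (j : ℤ) ≤ ⌈a₀ - K⌉ := by exact_mod_cast h3
      dsimp only
      omega
    · push Not at hq
      exact absurd (evalInt_eq_zero _ hq) hp
  · exact absurd rfl hp

theorem formalMul_XBracket (L : ℂ⟦X⟧) (c r : ℚ) (u v w : V) (q n : ℤ) (x : ℚ) :
    formalMul (expDelta L (1, 0, c) (0, -1, 1) r) (S.XBracket L (1, 0, c) u v w) (q, -(n + r), x)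
      = ∑ᶠ j : ℕ, expCoeff L (n + r) j • ∑ᶠ p : ℤ, ((L : LaurentSeries ℂ) ^ p).coeff (q - j) •
          S.modeX (x - (n + r) - c * q) (S.bracket u v p) w := by
  rw [expDelta, formalMul_formalSum _ (expDelta_exponent_injective r c)]
  have hinj : Function.Injective fun j : ℕ => ((n, j) : ℤ × ℕ) := by
    intro j j' h
    simpa using h
  rw [finsum_eq_finsum_comp _ hinj]
  · refine finsum_congr fun j => ?_
    rw [XBracket_apply, if_pos (by simp), evalInt_of_eq (n := q - j) _ (by simp)]
    congr 1
    refine finsum_congr fun p => ?_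
    congr 3
    simp
    ring_nf
  · rintro ⟨m, j⟩ hp
    rw [XBracket_apply, if_neg, smul_zero]
    intro h
    simp only [Prod.smul_mk, Prod.mk_add_mk, Prod.mk_sub_mk, smul_eq_mul, mul_one, mul_zero,
      add_zero, mul_neg] at h
    have : (m : ℚ) = n := by linarith
    exact hp j (by rw [show m = n by exact_mod_cast this])

theorem formalMul_XBracket_eq_zero (L : ℂ⟦X⟧) (c r : ℚ) (u v w : V) {a : ℚ × ℚ × ℚ}
    (ha : (∀ q : ℤ, a.1 ≠ q) ∨ ∀ n : ℤ, a.2.1 ≠ -(n + r)) :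
    formalMul (expDelta L (1, 0, c) (0, -1, 1) r) (S.XBracket L (1, 0, c) u v w) a = 0 := by
  rw [expDelta, formalMul_formalSum _ (expDelta_exponent_injective r c)]
  refine finsum_eq_zero_of_forall_eq_zero fun p => ?_
  obtain ⟨n, j⟩ := p
  obtain ⟨a₀, a₁, a₂⟩ := a
  rw [XBracket_apply]
  simp only [Prod.smul_mk, Prod.mk_add_mk, Prod.mk_sub_mk, smul_eq_mul, mul_one, mul_zero,
    add_zero, zero_add, mul_neg, sub_neg_eq_add]
  split_ifs with h
  · rw [evalInt_eq_zero, smul_zero]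
    intro q hq
    rcases ha with ha | ha
    · exact ha (q + j) (by push_cast; linarith)
    · exact ha n (by dsimp only; linarith)
  · rw [smul_zero]

/-- Two exchanges of summation: one substitutes `y = L` in `Y[u,y]v`, the other absorbs the factor
`e^{(n+r)L}` of the delta function into `e^{kL/2}`. -/
theorem formalMul_XBracket_of_mem {L : ℂ⟦X⟧} (hL : PowerSeries.constantCoeff L = 0)
    (hL1 : PowerSeries.coeff 1 L ≠ 0) (c r : ℚ) {k : ℤ} {u : V} (hu : u ∈ S.deg k) (v w : V)
    (q n : ℤ) (x : ℚ) :
    formalMul (expDelta L (1, 0, c) (0, -1, 1) r) (S.XBracket L (1, 0, c) u v w) (q, -(n + r), x)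
      = ∑ᶠ m : ℤ, (expLaurent L (n + r + k / 2) m).coeff q •
          S.modeX (x - (n + r) - c * q) (S.mode m u v) w := by
  rw [formalMul_XBracket]
  obtain ⟨K, hK⟩ := S.exists_mode_eq_zero u v
  set y := x - (n + r) - c * q
  have hK' : ∀ m, S.modeX y (S.mode m u v) w ≠ 0 → K ≤ m := by
    intro m hm
    by_contra hc
    exact hm (by rw [hK m (not_le.mp hc), map_zero, LinearMap.zero_apply])
  have hX : ∀ p : ℤ, S.modeX y (S.bracket u v p) w
      = ∑ᶠ m : ℤ, (expLaurent PowerSeries.X ((k : ℚ) / 2) m).coeff p •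
          S.modeX y (S.mode m u v) w := by
    intro p
    rw [S.bracket_of_mem hu, ← LinearMap.flip_apply, map_finsum]
    · refine finsum_congr fun m => ?_
      rw [map_smul, LinearMap.flip_apply]
    · refine (Set.finite_Icc K p).subset fun m hm => Set.mem_Icc.mpr ⟨?_, ?_⟩
      · by_contra hc
        exact hm (by dsimp only; rw [hK m (not_le.mp hc), smul_zero])
      · by_contra hc
        exact hm (by dsimp only; rw [coeff_expLaurent_X_eq_zero _ (not_le.mp hc), zero_smul])
  have hinner : ∀ q' : ℤ, ∑ᶠ p : ℤ, ((L : LaurentSeries ℂ) ^ p).coeff q' •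
      S.modeX y (S.bracket u v p) w
        = ∑ᶠ m : ℤ, (expLaurent L ((k : ℚ) / 2) m).coeff q' • S.modeX y (S.mode m u v) w := by
    intro q'
    simp only [hX]
    rw [finsum_smul_finsum_smul]
    · simp only [finsum_coeff_zpow_mul_expLaurent hL hL1]
    · refine ((Set.finite_Icc K q').prod (Set.finite_Icc K q')).subset ?_
      rintro ⟨p, m⟩ ⟨h1, h2⟩
      have h3 : p ≤ q' := by
        by_contra hc
        exact h1 (by dsimp only; rw [coeff_zpow_eq_zero hL hL1 (not_le.mp hc), zero_mul])
      have h4 : m ≤ p := by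
        by_contra hc
        exact h1 (by dsimp only; rw [coeff_expLaurent_X_eq_zero _ (not_le.mp hc), mul_zero])
      have h5 := hK' m h2
      exact Set.mk_mem_prod (Set.mem_Icc.mpr ⟨by omega, h3⟩) (Set.mem_Icc.mpr ⟨h5, by omega⟩)
  simp only [hinner]
  rw [finsum_smul_finsum_smul]
  · refine finsum_congr fun m => ?_
    rw [← expLaurent_add hL, coeff_coe_mul]
    rfl
  · refine (finite_box K q).subset ?_
    rintro ⟨j, m⟩ ⟨h1, h2⟩
    refine ⟨hK' m h2, ?_⟩
    by_contra hc
    apply h1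
    dsimp only at hc ⊢
    -- `e^{sL}(e^L-1)^m` has no terms below degree `m`: it combines powers `L^p` with `p ≥ m`, each
    -- starting in degree `p`.
    rw [← finsum_coeff_zpow_mul_expLaurent hL hL1, finsum_eq_zero_of_forall_eq_zero, mul_zero]
    intro p
    rcases lt_or_ge p m with h | h
    · rw [coeff_expLaurent_X_eq_zero _ h, mul_zero]
    · rw [coeff_zpow_eq_zero hL hL1 (by omega), zero_mul]

theorem constantCoeff_logOnePlus : PowerSeries.constantCoeff logOnePlus = 0 :=
  PowerSeries.constantCoeff_log

theorem coeff_one_logOnePlus : PowerSeries.coeff 1 logOnePlus ≠ 0 := by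
  rw [logOnePlus, PowerSeries.coeff_one_log]
  exact one_ne_zero

theorem coeff_one_X_ne_zero : PowerSeries.coeff 1 (PowerSeries.X : ℂ⟦X⟧) ≠ 0 := by
  rw [PowerSeries.coeff_one_X]
  exact one_ne_zero

/-! ### The commutator formula -/

theorem superCommutator_apply (i j : ZMod 2) (u v w : V) (a : ℚ × ℚ) :
    S.superCommutator i j u v w a = S.modeX a.1 u (S.modeX a.2 v w)
      - paritySign i j • S.modeX a.2 v (S.modeX a.1 u w) := rfl

/-- The degree of the inner vector grows with `m`; shifting the mode index by `m` makes the coset of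
admissible exponents independent of `m`. -/
theorem modeX_mode {k l : ℤ} {i : ZMod 2} {u v : V} (hu : u ∈ S.deg k) (hi : u ∈ S.par i)
    (hv : v ∈ S.deg l) (w : V) (m : ℤ) (a : ℚ) :
    S.modeX a (S.mode m u v) w
      = evalInt (fun n => S.mode (n - m) (S.mode m u v) w) (a - (k : ℚ) / 2 - (l : ℚ) / 2) := by
  rw [S.modeX_of_mem (S.mode_mem_deg hu hi hv m)]
  by_cases h : ∃ n : ℤ, a - (k : ℚ) / 2 - (l : ℚ) / 2 = n
  · obtain ⟨n, hn⟩ := h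
    rw [evalInt_of_eq _ hn, evalInt_of_eq (n := n - m)]
    push_cast
    linarith
  · push Not at h
    rw [evalInt_eq_zero _ h, evalInt_eq_zero]
    intro n hn
    apply h (n + m)
    push_cast at hn ⊢
    linarith

/-- At the exponent `-(n+r)` of `x₁`, the mode of `u` is `b = -N` with `N = n + t`. The residue
gives `C(N-1, -1-m) = C(-b-1, -1-m)`, as in `mode_commutator`. At exponents outside the cosets of
the degrees both sides vanish. -/
theorem superCommutator_of_mem {k l t : ℤ} {i j : ZMod 2} {u v : V} (hu : u ∈ S.deg k)
    (hi : u ∈ S.par i) (hv : v ∈ S.deg l) (hj : v ∈ S.par j) (w : V) {r : ℚ}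
    (hr : r + (k : ℚ) / 2 = t) :
    S.superCommutator i j u v w
      = res (formalMul (expDelta PowerSeries.X (1, 0, 0) (0, -1, 1) r)
          (S.XBracket PowerSeries.X (1, 0, 0) u v w)) := by
  funext ⟨x₁, x₂⟩
  rw [superCommutator_apply, res]
  by_cases h : ∃ n : ℤ, x₁ = -(n + r)
  · obtain ⟨n, rfl⟩ := h
    have h1 := S.formalMul_XBracket_of_mem PowerSeries.constantCoeff_X coeff_one_X_ne_zero 0 r hu v w
      (-1) n x₂
    rw [Int.cast_neg, Int.cast_one] at h1
    rw [h1]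
    have hN : (n : ℚ) + r + (k : ℚ) / 2 = ((n + t : ℤ) : ℚ) := by push_cast; linarith
    have hb : -((n : ℚ) + r) - (k : ℚ) / 2 = ((-(n + t) : ℤ) : ℚ) := by push_cast; linarith
    rw [hN, S.modeX_of_mem hu, S.modeX_of_mem hu, evalInt_of_eq _ hb, evalInt_of_eq _ hb]
    simp only [coeff_neg_one_expLaurent_X, S.modeX_mode hu hi hv]
    rw [S.modeX_of_mem hv, S.modeX_of_mem hv]
    by_cases hc : ∃ c : ℤ, x₂ - (l : ℚ) / 2 = c
    · obtain ⟨c, hc⟩ := hc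
      rw [evalInt_of_eq _ hc, evalInt_of_eq _ hc, S.mode_commutator hi hj]
      refine finsum_congr fun m => ?_
      rw [evalInt_of_eq (n := -(n + t) + c), neg_neg]
      push_cast at hb ⊢
      linarith
    · push Not at hc
      rw [evalInt_eq_zero _ hc, evalInt_eq_zero _ hc, map_zero, smul_zero, sub_zero]
      refine (finsum_eq_zero_of_forall_eq_zero fun m => ?_).symm
      rw [evalInt_eq_zero, smul_zero]
      intro q hq
      apply hc (q + (n + t))
      push_cast at hb ⊢
      linarith
  · push Not at h
    rw [S.formalMul_XBracket_eq_zero _ _ _ _ _ _ (Or.inr h)]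
    have hx : ∀ n : ℤ, x₁ - (k : ℚ) / 2 ≠ n := by
      intro n hn
      apply h (-n - t)
      push_cast
      linarith
    rw [S.modeX_of_mem hu, S.modeX_of_mem hu, evalInt_eq_zero _ hx, evalInt_eq_zero _ hx, map_zero,
      smul_zero, sub_zero]

/-- No homogeneity is assumed here, so bilinearity of the residue in `u` and `v` can be read off
from this formula. -/
theorem res_formalMul_XBracket (r : ℚ) (u v w : V) (n : ℤ) (x : ℚ) :
    res (formalMul (expDelta PowerSeries.X (1, 0, 0) (0, -1, 1) r)
        (S.XBracket PowerSeries.X (1, 0, 0) u v w)) (-(n + r), x)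
      = ∑ᶠ j : ℕ, expCoeff PowerSeries.X (n + r) j •
          S.modeX (x - (n + r)) (S.bracket u v (-1 - j)) w := by
  have h := S.formalMul_XBracket PowerSeries.X 0 r u v w (-1) n x
  rw [Int.cast_neg, Int.cast_one] at h
  rw [res, h]
  refine finsum_congr fun j => ?_
  rw [finsum_eq_single _ (-1 - (j : ℤ))]
  · rw [PowerSeries.coe_X, ← RatFunc.single_zpow, HahnSeries.coeff_single_same, one_smul, zero_mul,
      sub_zero]
  · intro p hp
    rw [PowerSeries.coe_X, ← RatFunc.single_zpow, HahnSeries.coeff_single_of_ne hp.symm, zero_smul]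

theorem res_formalMul_XBracket_eq_zero {r x₁ : ℚ} (h : ∀ n : ℤ, x₁ ≠ -(n + r)) (u v w : V)
    (x₂ : ℚ) : res (formalMul (expDelta PowerSeries.X (1, 0, 0) (0, -1, 1) r)
      (S.XBracket PowerSeries.X (1, 0, 0) u v w)) (x₁, x₂) = 0 :=
  S.formalMul_XBracket_eq_zero _ _ _ _ _ _ (Or.inr h)

theorem finite_res_support (r : ℚ) (u v w : V) (n : ℤ) (x : ℚ) :
    (Function.support fun j : ℕ => expCoeff PowerSeries.X (n + r) j •
      S.modeX (x - (n + r)) (S.bracket u v (-1 - j)) w).Finite := by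
  obtain ⟨K, hK⟩ := S.exists_bracket_eq_zero u v
  refine (Set.finite_Iic (-1 - K).toNat).subset fun j hj => Set.mem_Iic.mpr ?_
  by_contra hc
  apply hj
  dsimp only
  rw [hK _ (by omega), map_zero, LinearMap.zero_apply, smul_zero]

/-- The right-hand side of the commutator formula, as a bilinear map. -/
def commutatorResidue (r : ℚ) (w : V) : V →ₗ[ℂ] V →ₗ[ℂ] ℚ × ℚ → V :=
  LinearMap.mk₂ ℂ (fun u v => res (formalMul (expDelta PowerSeries.X (1, 0, 0) (0, -1, 1) r)
      (S.XBracket PowerSeries.X (1, 0, 0) u v w)))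
    (fun u u' v => by
      funext ⟨x₁, x₂⟩
      rw [Pi.add_apply]
      by_cases h : ∃ n : ℤ, x₁ = -(n + r)
      · obtain ⟨n, rfl⟩ := h
        simp only [res_formalMul_XBracket]
        rw [← finsum_add_distrib (S.finite_res_support r u v w n x₂)
          (S.finite_res_support r u' v w n x₂)]
        refine finsum_congr fun j => ?_
        simp only [bracket_eq_modeBracket, map_add, LinearMap.add_apply, smul_add]
      · push Not at h
        simp only [S.res_formalMul_XBracket_eq_zero h, add_zero])
    (fun z u v => by
      funext ⟨x₁, x₂⟩
      rw [Pi.smul_apply]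
      by_cases h : ∃ n : ℤ, x₁ = -(n + r)
      · obtain ⟨n, rfl⟩ := h
        simp only [res_formalMul_XBracket]
        rw [smul_finsum]
        refine finsum_congr fun j => ?_
        simp only [bracket_eq_modeBracket, map_smul, LinearMap.smul_apply]
        rw [smul_comm]
      · push Not at h
        simp only [S.res_formalMul_XBracket_eq_zero h, smul_zero])
    (fun u v v' => by
      funext ⟨x₁, x₂⟩
      rw [Pi.add_apply]
      by_cases h : ∃ n : ℤ, x₁ = -(n + r)
      · obtain ⟨n, rfl⟩ := h
        simp only [res_formalMul_XBracket]
        rw [← finsum_add_distrib (S.finite_res_support r u v w n x₂)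
          (S.finite_res_support r u v' w n x₂)]
        refine finsum_congr fun j => ?_
        simp only [bracket_eq_modeBracket, map_add, LinearMap.add_apply, smul_add]
      · push Not at h
        simp only [S.res_formalMul_XBracket_eq_zero h, add_zero])
    (fun z u v => by
      funext ⟨x₁, x₂⟩
      rw [Pi.smul_apply]
      by_cases h : ∃ n : ℤ, x₁ = -(n + r)
      · obtain ⟨n, rfl⟩ := h
        simp only [res_formalMul_XBracket]
        rw [smul_finsum]
        refine finsum_congr fun j => ?_
        simp only [bracket_eq_modeBracket, map_smul, LinearMap.smul_apply]
        rw [smul_comm]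
      · push Not at h
        simp only [S.res_formalMul_XBracket_eq_zero h, smul_zero])

/-- The supercommutator as a bilinear map. -/
def superCommutatorMap (i j : ZMod 2) (w : V) : V →ₗ[ℂ] V →ₗ[ℂ] ℚ × ℚ → V :=
  LinearMap.mk₂ ℂ (fun u v => S.superCommutator i j u v w)
    (fun u u' v => by
      funext a
      simp only [superCommutator_apply, Pi.add_apply, map_add, LinearMap.add_apply, smul_add]
      abel)
    (fun z u v => by
      funext a
      simp only [superCommutator_apply, Pi.smul_apply, map_smul, LinearMap.smul_apply, smul_sub]
      rw [smul_comm])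
    (fun u v v' => by
      funext a
      simp only [superCommutator_apply, Pi.add_apply, map_add, LinearMap.add_apply, smul_add]
      abel)
    (fun z u v => by
      funext a
      simp only [superCommutator_apply, Pi.smul_apply, map_smul, LinearMap.smul_apply, smul_sub]
      rw [smul_comm])

/-- The span of the homogeneous vectors of parity `i` whose degree is in `-r + ℤ`. -/
def cosetSpan (r : ℚ) (i : ZMod 2) : Submodule ℂ V :=
  Submodule.span ℂ {u | u ∈ S.par i ∧ ∃ k t : ℤ, u ∈ S.deg k ∧ r + (k : ℚ) / 2 = t}

/-- Both sides are bilinear, so it suffices to check homogeneous generators, where only the class of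
the degree modulo `ℤ` enters. -/
theorem superCommutator_of_mem_cosetSpan {i j : ZMod 2} {u v : V} {r s : ℚ}
    (hu : u ∈ S.cosetSpan r i) (hv : v ∈ S.cosetSpan s j) (w : V) :
    S.superCommutator i j u v w
      = res (formalMul (expDelta PowerSeries.X (1, 0, 0) (0, -1, 1) r)
          (S.XBracket PowerSeries.X (1, 0, 0) u v w)) := by
  change S.superCommutatorMap i j w u v = S.commutatorResidue r w u v
  refine LinearMap.eqOn_span (f := (S.superCommutatorMap i j w).flip v)
    (g := (S.commutatorResidue r w).flip v) ?_ hu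
  rintro u ⟨hi, k, t, hk, ht⟩
  refine LinearMap.eqOn_span (f := S.superCommutatorMap i j w u)
    (g := S.commutatorResidue r w u) ?_ hv
  rintro v ⟨hj, l, t', hl, -⟩
  exact S.superCommutator_of_mem hk hi hl hj w ht

theorem rel_add_half (k : ℤ) : ∃ t : ℤ, rel k + (k : ℚ) / 2 = t := by
  -- The sum is twice `k/2` minus the floor of `k/2`.
  refine ⟨k - ⌊(k : ℚ) / 2⌋, ?_⟩
  have := Int.floor_add_fract ((k : ℚ) / 2)
  rw [rel]
  push_cast
  linarith

theorem mem_cosetSpan {k : ℤ} {i : ZMod 2} {u : V} (hk : u ∈ S.deg k) (hi : u ∈ S.par i) :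
    u ∈ S.cosetSpan (rel k) i := by
  obtain ⟨t, ht⟩ := rel_add_half k
  exact Submodule.subset_span ⟨hi, k, t, hk, ht⟩

/-- Each coefficient combines the vectors `u_n v`, whose degrees differ by integers. The sum `rel k
+ rel l` may equal `1`, which is harmless since only its class modulo `ℤ` matters. -/
theorem bracket_mem_cosetSpan {k l : ℤ} {i j : ZMod 2} {u v : V} (hk : u ∈ S.deg k)
    (hi : u ∈ S.par i) (hl : v ∈ S.deg l) (hj : v ∈ S.par j) (m : ℤ) :
    S.bracket u v m ∈ S.cosetSpan (rel k + rel l) (i + j) := by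
  rw [S.bracket_of_mem hk]
  refine finsum_induction (· ∈ S.cosetSpan (rel k + rel l) (i + j)) (zero_mem _)
    (fun _ _ => add_mem) fun n => Submodule.smul_mem _ _ (Submodule.subset_span ⟨?_, ?_⟩)
  · exact S.Y_par i j u v n hi hj
  · obtain ⟨t, ht⟩ := rel_add_half k
    obtain ⟨t', ht'⟩ := rel_add_half l
    refine ⟨_, t + t' + n, S.mode_mem_deg hk hi hl n, ?_⟩
    push_cast
    linarith

/-! ### The Jacobi identity for `X`-operators -/

/-- Since `e^{n log(1-x₂/x₁)} (x₁/x₀)^n = x₀^{-n} (x₁-x₂)^n`, this is the delta function of the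
Jacobi identity without its prefactor `x₀⁻¹`, hence the shift by `(1, 0, 0)`. -/
theorem expDelta_logOneMinus_eq :
    expDelta logOneMinus (0, -1, 1) (-1, 1, 0) 0 = formalSum
      (fun p : ℤ × ℕ =>
        (((1 ^ p.1 : ℤˣ) : ℤ) : ℂ) * ((-1) ^ p.2 * ((Ring.choose p.1 p.2 : ℤ) : ℂ)))
      (fun p => castTriple ((p.1 - (p.2 : ℤ)) • (0, 1, 0) + (p.2 : ℤ) • (0, 0, 1)
        - (p.1 + 1) • (1, 0, 0) + (1, 0, 0))) := by
  rw [expDelta]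
  congr 1
  · funext p
    rw [add_zero, expCoeff_logOneMinus]
    simp
  · funext p
    simp [castTriple_apply]
    ring

theorem negExpDelta_logOneMinus_eq :
    negExpDelta logOneMinus (0, 1, -1) (-1, 0, 1) = formalSum
      (fun p : ℤ × ℕ =>
        ((((-1) ^ p.1 : ℤˣ) : ℤ) : ℂ) * ((-1) ^ p.2 * ((Ring.choose p.1 p.2 : ℤ) : ℂ)))
      (fun p => castTriple ((p.1 - (p.2 : ℤ)) • (0, 0, 1) + (p.2 : ℤ) • (0, 1, 0)
        - (p.1 + 1) • (1, 0, 0) + (1, 0, 0))) := by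
  rw [negExpDelta]
  congr 1
  · funext p
    rw [expCoeff_logOneMinus]
    congr 1
    rcases Int.even_or_odd p.1 with h | h
    · simp [h.neg_one_zpow]
    · simp [h.neg_one_zpow]
  · funext p
    simp [castTriple_apply]
    ring

theorem modeX_add_half {k : ℤ} {u : V} (hu : u ∈ S.deg k) (w : V) (n : ℤ) :
    S.modeX ((k : ℚ) / 2 + n) u w = S.mode n u w := by
  rw [S.modeX_of_mem hu, evalInt_of_eq]
  ring

theorem modeX_eq_zero {k : ℤ} {u : V} (hu : u ∈ S.deg k) (w : V) {a : ℚ}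
    (h : ∀ n : ℤ, a ≠ (k : ℚ) / 2 + n) : S.modeX a u w = 0 := by
  rw [S.modeX_of_mem hu, evalInt_eq_zero]
  intro n hn
  exact h n (by linarith)

theorem liftLastTwo_XX (u v w : V) (a : ℚ × ℚ × ℚ) : liftLastTwo (S.XX u v w) a
    = if a.1 = 0 then S.modeX a.2.1 u (S.modeX a.2.2 v w) else 0 := rfl

theorem liftLastTwo_XXop (u v w : V) (a : ℚ × ℚ × ℚ) : liftLastTwo (S.XXop u v w) a
    = if a.1 = 0 then S.modeX a.2.2 v (S.modeX a.2.1 u w) else 0 := rfl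

theorem liftLastTwo_XX_castTriple {k l : ℤ} {u v : V} (hu : u ∈ S.deg k) (hv : v ∈ S.deg l)
    (w : V) (x : ℤ × ℤ × ℤ) :
    liftLastTwo (S.XX u v w) ((0, (k : ℚ) / 2, (l : ℚ) / 2) + castTriple x)
      = S.leftSeries u v w x := by
  rw [liftLastTwo_XX]
  simp only [castTriple_apply, Prod.mk_add_mk, zero_add, S.modeX_add_half hu, S.modeX_add_half hv,
    Int.cast_eq_zero]
  rfl

theorem liftLastTwo_XXop_castTriple {k l : ℤ} {u v : V} (hu : u ∈ S.deg k) (hv : v ∈ S.deg l)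
    (w : V) (x : ℤ × ℤ × ℤ) :
    liftLastTwo (S.XXop u v w) ((0, (k : ℚ) / 2, (l : ℚ) / 2) + castTriple x)
      = S.rightSeries u v w x := by
  rw [liftLastTwo_XXop]
  simp only [castTriple_apply, Prod.mk_add_mk, zero_add, S.modeX_add_half hu, S.modeX_add_half hv,
    Int.cast_eq_zero]
  rfl

theorem exists_eq_castTriple {k l : ℤ} {a : ℚ × ℚ × ℚ} (h0 : ∃ q : ℤ, a.1 = q)
    (h1 : ∃ n : ℤ, a.2.1 = (k : ℚ) / 2 + n) (h2 : ∃ n : ℤ, a.2.2 = (l : ℚ) / 2 + n) :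
    ∃ x, a = (0, (k : ℚ) / 2, (l : ℚ) / 2) + castTriple x := by
  obtain ⟨a₀, a₁, a₂⟩ := a
  obtain ⟨q, rfl⟩ := h0
  obtain ⟨n, rfl⟩ := h1
  obtain ⟨m, rfl⟩ := h2
  exact ⟨(q, n, m), by simp [castTriple_apply]⟩

theorem liftLastTwo_XX_eq_zero {k l : ℤ} {u v : V} (hu : u ∈ S.deg k) (hv : v ∈ S.deg l) (w : V)
    (a : ℚ × ℚ × ℚ) (ha : ∀ x, a ≠ (0, (k : ℚ) / 2, (l : ℚ) / 2) + castTriple x) :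
    liftLastTwo (S.XX u v w) a = 0 := by
  rw [liftLastTwo_XX]
  split_ifs with h0
  · by_cases h1 : ∃ n : ℤ, a.2.1 = (k : ℚ) / 2 + n
    · rw [S.modeX_eq_zero hv, map_zero]
      intro n hn
      obtain ⟨x, hx⟩ := exists_eq_castTriple ⟨0, by simpa using h0⟩ h1 ⟨n, hn⟩
      exact ha x hx
    · push Not at h1
      exact S.modeX_eq_zero hu _ h1
  · rfl

theorem liftLastTwo_XXop_eq_zero {k l : ℤ} {u v : V} (hu : u ∈ S.deg k) (hv : v ∈ S.deg l) (w : V)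
    (a : ℚ × ℚ × ℚ) (ha : ∀ x, a ≠ (0, (k : ℚ) / 2, (l : ℚ) / 2) + castTriple x) :
    liftLastTwo (S.XXop u v w) a = 0 := by
  rw [liftLastTwo_XXop]
  split_ifs with h0
  · by_cases h1 : ∃ n : ℤ, a.2.1 = (k : ℚ) / 2 + n
    · rw [S.modeX_eq_zero hv]
      intro n hn
      obtain ⟨x, hx⟩ := exists_eq_castTriple ⟨0, by simpa using h0⟩ h1 ⟨n, hn⟩
      exact ha x hx
    · push Not at h1
      rw [S.modeX_eq_zero hu _ h1, map_zero]
  · rfl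

theorem mulExists_XX (u v w : V) :
    MulExists (expDelta logOneMinus (0, -1, 1) (-1, 1, 0) 0) (liftLastTwo (S.XX u v w)) := by
  obtain ⟨K, hK⟩ := S.exists_modeX_eq_zero v w
  refine mulExists_formalSum _ _ _ fun a => ?_
  refine ((Set.finite_singleton (-a.1).num).prod
    (Set.finite_Iic (⌈a.2.2 - K⌉).toNat)).subset ?_
  rintro ⟨n, j⟩ hp
  change liftLastTwo _ _ ≠ 0 at hp
  rw [liftLastTwo_XX] at hp
  obtain ⟨a₀, a₁, a₂⟩ := a
  simp only [Prod.smul_mk, Prod.mk_add_mk, Prod.mk_sub_mk, smul_eq_mul, mul_one, mul_zero,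
    add_zero, zero_add, mul_neg, sub_neg_eq_add] at hp
  split_ifs at hp with h
  · have h1 : -a₀ = (n : ℚ) := by linarith
    refine Set.mk_mem_prod (by simp [h1]) (Set.mem_Iic.mpr ?_)
    have h2 : (j : ℚ) ≤ a₂ - K := by
      by_contra hc
      exact hp (by rw [hK _ (by linarith), map_zero])
    have h3 : ((j : ℤ) : ℚ) ≤ ⌈a₂ - K⌉ := by
      push_cast
      exact h2.trans (Int.le_ceil _)
    have h4 : (j : ℤ) ≤ ⌈a₂ - K⌉ := by exact_mod_cast h3
    dsimp only
    omega
  · exact absurd rfl hp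

theorem mulExists_XXop (u v w : V) :
    MulExists (negExpDelta logOneMinus (0, 1, -1) (-1, 0, 1)) (liftLastTwo (S.XXop u v w)) := by
  obtain ⟨K, hK⟩ := S.exists_modeX_eq_zero u w
  refine mulExists_formalSum _ _ _ fun a => ?_
  refine ((Set.finite_singleton (-a.1).num).prod
    (Set.finite_Iic (⌈a.2.1 - K⌉).toNat)).subset ?_
  rintro ⟨n, j⟩ hp
  change liftLastTwo _ _ ≠ 0 at hp
  rw [liftLastTwo_XXop] at hp
  obtain ⟨a₀, a₁, a₂⟩ := a
  simp only [Prod.smul_mk, Prod.mk_add_mk, Prod.mk_sub_mk, smul_eq_mul, mul_one, mul_zero,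
    add_zero, zero_add, mul_neg, sub_neg_eq_add] at hp
  split_ifs at hp with h
  · have h1 : -a₀ = (n : ℚ) := by linarith
    refine Set.mk_mem_prod (by simp [h1]) (Set.mem_Iic.mpr ?_)
    have h2 : (j : ℚ) ≤ a₁ - K := by
      by_contra hc
      exact hp (by rw [hK _ (by linarith), map_zero])
    have h3 : ((j : ℤ) : ℚ) ≤ ⌈a₁ - K⌉ := by
      push_cast
      exact h2.trans (Int.le_ceil _)
    have h4 : (j : ℤ) ≤ ⌈a₁ - K⌉ := by exact_mod_cast h3
    dsimp only
    omega
  · exact absurd rfl hp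

theorem castTriple_add_injective {e : ℤ × ℕ → ℤ × ℤ × ℤ} (he : Function.Injective e) (t : ℤ × ℤ × ℤ) :
    Function.Injective fun p => castTriple (e p + t) :=
  fun _ _ h => he (add_right_cancel (castTriple_injective h))

theorem jacobi_X {k l : ℤ} {i j : ZMod 2} {u v : V} (hu : u ∈ S.deg k) (hi : u ∈ S.par i)
    (hv : v ∈ S.deg l) (hj : v ∈ S.par j) (w : V) :
    monomialMul (-1, 0, 0)
        (formalMul (expDelta logOneMinus (0, -1, 1) (-1, 1, 0) 0) (liftLastTwo (S.XX u v w)))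
      - paritySign i j •
        monomialMul (-1, 0, 0)
          (formalMul (negExpDelta logOneMinus (0, 1, -1) (-1, 0, 1))
            (liftLastTwo (S.XXop u v w)))
      = monomialMul (0, -1, 0)
          (formalMul (expDelta logOnePlus (1, 0, -1) (0, -1, 1) (rel k))
            (S.XBracket logOnePlus (1, 0, -1) u v w)) := by
  obtain ⟨t, ht⟩ := rel_add_half k
  funext a
  rw [Pi.sub_apply, Pi.smul_apply]
  simp only [monomialMul]
  by_cases ha : ∃ x, a = (0, (k : ℚ) / 2, (l : ℚ) / 2) + castTriple x
  · obtain ⟨x, rfl⟩ := ha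
    have hshift : (0, (k : ℚ) / 2, (l : ℚ) / 2) + castTriple x - (-1, 0, 0)
        = (0, (k : ℚ) / 2, (l : ℚ) / 2) + castTriple (x + (1, 0, 0)) := by
      simp [castTriple_apply]
    have hjac := congrFun (S.jacobi i j u v w hi hj) x
    rw [Pi.sub_apply, Pi.smul_apply] at hjac
    rw [hshift, expDelta_logOneMinus_eq, negExpDelta_logOneMinus_eq,
      formalMul_castTriple _ left_exponent_injective (1, 0, 0) (fun _ => rfl) _
        (S.liftLastTwo_XX_castTriple hu hv w),
      formalMul_castTriple _ right_exponent_injective (1, 0, 0) (fun _ => rfl) _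
        (S.liftLastTwo_XXop_castTriple hu hv w)]
    refine hjac.trans ((S.formalMul_iterateSeries u v w x).trans ?_)
    obtain ⟨x₀, x₁, x₂⟩ := x
    -- The exponent `x₁ + k/2` is raised by one by the prefactor `x₁⁻¹`; solving `x₁ + k/2 + 1 = -(n
    -- + rel k)` gives `n = -(x₁ + 1 + t)`.
    have hpt : (0, (k : ℚ) / 2, (l : ℚ) / 2) + castTriple (x₀, x₁, x₂) - (0, -1, 0)
        = ((x₀ : ℚ), -(((-(x₁ + 1 + t) : ℤ) : ℚ) + rel k), (l : ℚ) / 2 + x₂) := by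
      simp only [castTriple_apply, Prod.mk_add_mk, Prod.mk_sub_mk, Prod.mk.injEq]
      refine ⟨by ring, ?_, by ring⟩
      push_cast
      linarith
    rw [hpt, S.formalMul_XBracket_of_mem constantCoeff_logOnePlus coeff_one_logOnePlus _ _ hu]
    -- The exponent of `1 + x₀/x₂` becomes `-x₁ - 1`, the upper index in `formalMul_iterateSeries`.
    have hN : ((-(x₁ + 1 + t) : ℤ) : ℚ) + rel k + (k : ℚ) / 2 = ((-x₁ - 1 : ℤ) : ℚ) := by
      push_cast
      linarith
    refine finsum_congr fun m => ?_
    rw [hN, coeff_expLaurent_log, S.modeX_mode hu hi hv, evalInt_of_eq (n := x₀ + x₁ + x₂ + 1)]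
    push_cast
    linarith
  -- Off the coset `(0, k/2, l/2) + ℤ³` every product vanishes; on the right, a nonzero term would
  -- force all three exponents into that coset.
  · push Not at ha
    have ha' : ∀ x, a - (-1, 0, 0) ≠ (0, (k : ℚ) / 2, (l : ℚ) / 2) + castTriple x := by
      intro x hx
      apply ha (x - (1, 0, 0))
      rw [map_sub, ← add_sub_assoc, ← hx]
      ext <;> simp [castTriple_apply]
    rw [expDelta_logOneMinus_eq, negExpDelta_logOneMinus_eq,
      formalMul_castTriple_eq_zero _ (castTriple_add_injective left_exponent_injective _) _ (fun _ => rfl) _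
        (S.liftLastTwo_XX_eq_zero hu hv w) ha',
      formalMul_castTriple_eq_zero _ (castTriple_add_injective right_exponent_injective _) _ (fun _ => rfl) _
        (S.liftLastTwo_XXop_eq_zero hu hv w) ha', smul_zero, sub_zero]
    symm
    by_cases h0 : ∃ q : ℤ, a.1 = q
    · by_cases h1 : ∃ n : ℤ, a.2.1 + 1 = -(n + rel k)
      · obtain ⟨a₀, a₁, a₂⟩ := a
        obtain ⟨q, hq⟩ := h0
        obtain ⟨n, hn⟩ := h1
        dsimp only at hq hn
        have hpt : (a₀, a₁, a₂) - ((0, -1, 0) : ℚ × ℚ × ℚ) = ((q : ℚ), -((n : ℚ) + rel k), a₂) := by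
          simp only [Prod.mk_sub_mk, Prod.mk.injEq]
          exact ⟨by rw [hq, sub_zero], by rw [← hn]; ring, by ring⟩
        rw [hpt, S.formalMul_XBracket_of_mem constantCoeff_logOnePlus coeff_one_logOnePlus _ _ hu]
        refine finsum_eq_zero_of_forall_eq_zero fun m => ?_
        rw [S.modeX_mode hu hi hv, evalInt_eq_zero, smul_zero]
        intro y hy
        obtain ⟨x, hx⟩ := exists_eq_castTriple (k := k) (l := l) (a := (a₀, a₁, a₂)) ⟨q, hq⟩
          ⟨-n - t - 1, by push_cast; linarith⟩ ⟨y + n + t - q, by push_cast; linarith⟩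
        exact ha x hx
      · push Not at h1
        refine S.formalMul_XBracket_eq_zero _ _ _ _ _ _ (Or.inr fun n hn => h1 n ?_)
        simpa using hn
    · push Not at h0
      refine S.formalMul_XBracket_eq_zero _ _ _ _ _ _ (Or.inl fun q hq => h0 q ?_)
      simpa using hq

end VertexOperatorSuperalgebra

end

theorem mainTheorem6 {V : Type*} [AddCommGroup V] [Module ℂ V]
    (S : VertexOperatorSuperalgebra V) :
    -- the Jacobi identity for X-operators, in the variables x₀, x₁, x₂
    (∀ (k l : ℤ) (i j : ZMod 2) (u v w : V),
      u ∈ S.deg k → u ∈ S.par i → v ∈ S.deg l → v ∈ S.par j →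
      (MulExists (expDelta logOneMinus (0, -1, 1) (-1, 1, 0) 0) (liftLastTwo (S.XX u v w)) ∧
        MulExists (negExpDelta logOneMinus (0, 1, -1) (-1, 0, 1)) (liftLastTwo (S.XXop u v w)) ∧
        MulExists
          (expDelta logOnePlus (1, 0, -1) (0, -1, 1) (rel k))
          (S.XBracket logOnePlus (1, 0, -1) u v w)) ∧
      monomialMul (-1, 0, 0)
          (formalMul (expDelta logOneMinus (0, -1, 1) (-1, 1, 0) 0) (liftLastTwo (S.XX u v w)))
        - paritySign i j •
          monomialMul (-1, 0, 0)
            (formalMul (negExpDelta logOneMinus (0, 1, -1) (-1, 0, 1))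
              (liftLastTwo (S.XXop u v w)))
        = monomialMul (0, -1, 0)
            (formalMul
              (expDelta logOnePlus (1, 0, -1) (0, -1, 1) (rel k))
              (S.XBracket logOnePlus (1, 0, -1) u v w))) ∧
    -- the commutator formula for X(u, x₁) and X(v, x₂), with a formal variable y
    (∀ (k l : ℤ) (i j : ZMod 2) (u v w : V),
      u ∈ S.deg k → u ∈ S.par i → v ∈ S.deg l → v ∈ S.par j →
      MulExists
          (expDelta PowerSeries.X (1, 0, 0) (0, -1, 1) (rel k))
          (S.XBracket PowerSeries.X (1, 0, 0) u v w) ∧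
      S.superCommutator i j u v w
        = res (formalMul
            (expDelta PowerSeries.X (1, 0, 0) (0, -1, 1) (rel k))
            (S.XBracket PowerSeries.X (1, 0, 0) u v w))) ∧
    -- the commutator formula for X(Y[u₁, x₁]v₁, y₁) and X(Y[u₂, x₂]v₂, y₂): the coefficients of
    -- x₁^m x₂^n on both sides, as series in y₁, y₂
    (∀ (k₁ l₁ k₂ l₂ : ℤ) (i₁ j₁ i₂ j₂ : ZMod 2) (u₁ v₁ u₂ v₂ w : V),
      u₁ ∈ S.deg k₁ → u₁ ∈ S.par i₁ → v₁ ∈ S.deg l₁ → v₁ ∈ S.par j₁ →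
      u₂ ∈ S.deg k₂ → u₂ ∈ S.par i₂ → v₂ ∈ S.deg l₂ → v₂ ∈ S.par j₂ →
      ∀ m n : ℤ,
      MulExists
          (expDelta PowerSeries.X (1, 0, 0) (0, -1, 1)
            (rel k₁ + rel l₁))
          (S.XBracket PowerSeries.X (1, 0, 0) (S.bracket u₁ v₁ m) (S.bracket u₂ v₂ n) w) ∧
      S.superCommutator (i₁ + j₁) (i₂ + j₂) (S.bracket u₁ v₁ m) (S.bracket u₂ v₂ n) w
        = res (formalMul
            (expDelta PowerSeries.X (1, 0, 0) (0, -1, 1)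
              (rel k₁ + rel l₁))
            (S.XBracket PowerSeries.X (1, 0, 0) (S.bracket u₁ v₁ m) (S.bracket u₂ v₂ n) w))) := by
  refine ⟨fun k l i j u v w hu hi hv hj => ⟨⟨S.mulExists_XX u v w, S.mulExists_XXop u v w,
      S.mulExists_XBracket constantCoeff_logOnePlus coeff_one_logOnePlus _ _ u v w⟩,
      S.jacobi_X hu hi hv hj w⟩,
    fun k l i j u v w hu hi hv hj =>
      ⟨S.mulExists_XBracket PowerSeries.constantCoeff_X coeff_one_X_ne_zero _ _ u v w,
      S.superCommutator_of_mem_cosetSpan (S.mem_cosetSpan hu hi) (S.mem_cosetSpan hv hj) w⟩,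
    fun k₁ l₁ k₂ l₂ i₁ j₁ i₂ j₂ u₁ v₁ u₂ v₂ w hu₁ hi₁ hv₁ hj₁ hu₂ hi₂ hv₂ hj₂ m n =>
      ⟨S.mulExists_XBracket PowerSeries.constantCoeff_X coeff_one_X_ne_zero _ _ _ _ w,
      S.superCommutator_of_mem_cosetSpan (S.bracket_mem_cosetSpan hu₁ hi₁ hv₁ hj₁ m)
        (S.bracket_mem_cosetSpan hu₂ hi₂ hv₂ hj₂ n) w⟩⟩
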